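/- **Theorem (Universal uniform test).** Let $X$ be a computable metric space: a complete metric space $(X,d)$ with a dense sequence $(s_i)_{i\in\mathbb N}$ of ideal points such that the reals $d(s_i,s_j)$ are computable uniformly in $(i,j)$. Then there is a universal uniform randomness test on $X$, that is, a uniform randomness test $T_u$ such that for every uniform randomness test $T$ there is a real constant $c_T>0$ with $$T_u^\mu(x)\ \ge\ c_T\,T^\mu(x)\qquad\text{for all Borel probability measures }\mu\text{ on }X\text{ and all }x\in X .$$ Here $\mathcal M(X)$ is the set of Borel probability measures on $X$ with the Prokhorov metric $\rho$. Its ideal points $\mu_0,\mu_1,\dots$ are the probability measures concentrated on finitely many ideal points of $X$ with rational weights, numbered in a standard effective way. A name of $\mu\in\mathcal M(X)$ is a sequence $(n_k)_k$ of integers with $\rho(\mu_{n_k},\mu_{n_{k+1}})<2^{-k}$ for all $k$ and $\mu_{n_k}\to\mu$. A step function on $X$ takes a nonnegative rational value $q$ on a ball $B(s_i,r)$ with rational radius $r>0$ and the value $0$ elsewhere; step functions are numbered in a standard effective way. $\mathcal C(X,[0,\infty])$ is the set of pointwise suprema of families of step functions (these are the lower semicontinuous functions $X\to[0,\infty]$),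 and a description of $f\in\mathcal C(X,[0,\infty])$ is a finite (possibly empty) or infinite sequence of codes of step functions whose pointwise supremum is $f$. A function $T:\mathcal M(X)\to\mathcal C(X,[0,\infty])$, $\mu\mapsto T^\mu$, is constructive if some recursive operator on integer sequences maps every name of every $\mu\in\mathcal M(X)$ to a description of $T^\mu$; here a recursive operator is given by a recursive function on finite sequences of integers that is monotone for the prefix order, its value on an infinite sequence being the limit of its values on the finite prefixes. A uniform randomness test is a constructive function $T:\mathcal M(X)\to\mathcal C(X,[0,\infty])$ with $\int T^\mu\,d\mu\le 1$ for every $\mu\in\mathcal M(X)$. -/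

import Mathlib

open MeasureTheory Filter Topology
open scoped ENNReal NNReal

noncomputable section

namespace CompMetric

/-- Standard numbering of the rationals: the code `⟨⟨a, b⟩, c⟩` stands for `(a - b) / (c + 1)`. -/
def ratNum (n : ℕ) : ℝ :=
  ((n.unpair.1.unpair.1 : ℝ) - (n.unpair.1.unpair.2 : ℝ)) / ((n.unpair.2 : ℝ) + 1)

/-- Standard numbering of the positive rationals: `⟨a, b⟩` stands for `(a + 1) / (b + 1)`. -/
def posRatNum (n : ℕ) : ℝ := ((n.unpair.1 : ℝ) + 1) / ((n.unpair.2 : ℝ) + 1)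

/-- Standard numbering of the nonnegative rationals: `⟨a, b⟩` stands for `a / (b + 1)`. -/
def nnRatNum (n : ℕ) : ℝ≥0 := (n.unpair.1 : ℝ≥0) / ((n.unpair.2 : ℝ≥0) + 1)

/-- The Cauchy representation attached to a sequence `s` of ideal points: `σ` is a name of `x` if
`s (σ 0), s (σ 1), …` is a fast Cauchy sequence that converges to `x`. -/
def IsCauchyName {X : Type*} [PseudoMetricSpace X] (s : ℕ → X) (σ : ℕ → ℕ) (x : X) : Prop :=
  (∀ n, dist (s (σ n)) (s (σ (n + 1))) < (1 / 2 : ℝ) ^ n) ∧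
    Tendsto (fun n => s (σ n)) atTop (𝓝 x)

/-- A computable metric space structure on a complete metric space: a dense sequence of ideal
points whose mutual distances are computable reals, uniformly in the pair of indices. -/
structure ComputableMetricSpace (X : Type*) [MetricSpace X] [CompleteSpace X] where
  ideal : ℕ → X
  dense : DenseRange ideal
  dist_computable : ∃ f : ℕ × ℕ × ℕ → ℕ, Computable f ∧
    ∀ i j, IsCauchyName ratNum (fun n => f (i, j, n)) (dist (ideal i) (ideal j))

/-- An enumerative lattice structure on a complete lattice: a numbered family such that every
element is the supremum of a subfamily. -/
structure EnumerativeLattice (Y : Type*) [CompleteLattice Y] where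
  elem : ℕ → Y
  exists_eq_iSup : ∀ y, ∃ E : Set ℕ, y = ⨆ n ∈ E, elem n

/-- The canonical representation of an enumerative lattice: `E` is the set of the codes listed by
the (possibly empty) description, and the element described is the supremum. -/
def EnumerativeLattice.Describes {Y : Type*} [CompleteLattice Y] (L : EnumerativeLattice Y)
    (E : Set ℕ) (y : Y) : Prop :=
  y = ⨆ n ∈ E, L.elem n

/-- A recursive operator on sequences of integers, given by its action on finite prefixes:
a recursive function on finite sequences which is monotone for the prefix order. -/
structure IsRecursiveOperator (F : List ℕ → List ℕ) : Prop where
  computable : Computable F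
  monotone : ∀ u v : List ℕ, u <+: v → F u <+: F v

/-- The set of terms of the finite or infinite sequence which is the limit of the values of `F`
on the finite prefixes of `σ`. -/
def operatorOutput (F : List ℕ → List ℕ) (σ : ℕ → ℕ) : Set ℕ :=
  {m | ∃ k, m ∈ F ((List.range k).map σ)}

/-- A function from a metric space, represented through its ideal points `s`, to an enumerative
lattice is constructive if a recursive operator maps every name of every `x` to a description
of `f x`. -/
def IsConstructive {X Y : Type*} [PseudoMetricSpace X] [CompleteLattice Y] (s : ℕ → X)
    (L : EnumerativeLattice Y) (f : X → Y) : Prop :=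
  ∃ F : List ℕ → List ℕ, IsRecursiveOperator F ∧
    ∀ x σ, IsCauchyName s σ x → L.Describes (operatorOutput F σ) (f x)

section StepFunctions

variable {X Y : Type*} [MetricSpace X] [CompleteSpace X] [CompleteLattice Y]

/-- The `n`-th ideal ball, `n = ⟨i, j⟩`: centre `s_i`, radius the `j`-th positive rational. -/
def ComputableMetricSpace.idealBall (S : ComputableMetricSpace X) (n : ℕ) : Set X :=
  Metric.ball (S.ideal n.unpair.1) (posRatNum n.unpair.2)

open Classical in
/-- The step function with code `⟨i, j⟩`: value `p_j` on the `i`-th ideal ball, `⊥` elsewhere. -/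
def stepFun (S : ComputableMetricSpace X) (L : EnumerativeLattice Y) (n : ℕ) : X → Y :=
  fun x => if x ∈ S.idealBall n.unpair.1 then L.elem n.unpair.2 else ⊥

/-- The space `𝒞(X, Y)`: all pointwise suprema of families of step functions. -/
def LowerFun (S : ComputableMetricSpace X) (L : EnumerativeLattice Y) : Type _ :=
  {f : X → Y // ∃ E : Set ℕ, f = ⨆ n ∈ E, stepFun S L n}

namespace LowerFun

variable {S : ComputableMetricSpace X} {L : EnumerativeLattice Y}

instance : CoeFun (LowerFun S L) (fun _ => X → Y) := ⟨Subtype.val⟩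

instance : PartialOrder (LowerFun S L) := Subtype.partialOrder _

theorem exists_iSup_eq (A : Set (LowerFun S L)) :
    ∃ E : Set ℕ, (⨆ f ∈ A, f.1 : X → Y) = ⨆ n ∈ E, stepFun S L n := by
  choose E hE using fun f : LowerFun S L => f.2
  refine ⟨⋃ f ∈ A, E f, le_antisymm ?_ ?_⟩
  · refine iSup₂_le fun f hf => ?_
    rw [hE f]
    exact iSup₂_le fun n hn => le_iSup₂_of_le n (Set.mem_biUnion hf hn) le_rfl
  · refine iSup₂_le fun n hn => ?_
    obtain ⟨f, hf, hn⟩ := Set.mem_iUnion₂.1 hn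
    refine le_iSup₂_of_le f hf ?_
    rw [hE f]
    exact le_iSup₂_of_le n hn le_rfl

instance : SupSet (LowerFun S L) := ⟨fun A => ⟨⨆ f ∈ A, f.1, exists_iSup_eq A⟩⟩

instance : CompleteLattice (LowerFun S L) :=
  completeLatticeOfSup _ fun A =>
    ⟨fun f hf => show f.1 ≤ ⨆ g ∈ A, g.1 from le_iSup₂_of_le f hf le_rfl,
      fun g hg => show (⨆ f ∈ A, f.1) ≤ g.1 from iSup₂_le fun _ hf => hg hf⟩

theorem coe_iSup {ι : Sort*} (g : ι → LowerFun S L) : (⨆ i, g i).1 = ⨆ i, (g i).1 := by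
  show (⨆ f ∈ Set.range g, f.1) = _
  exact iSup_range

/-- The step function with code `n` as an element of `𝒞(X, Y)`. -/
def step (S : ComputableMetricSpace X) (L : EnumerativeLattice Y) (n : ℕ) : LowerFun S L :=
  ⟨stepFun S L n, {n}, by simp⟩

/-- The enumerative lattice structure of `𝒞(X, Y)` given by the step functions. -/
def enumerativeLattice (S : ComputableMetricSpace X) (L : EnumerativeLattice Y) :
    EnumerativeLattice (LowerFun S L) where
  elem := step S L
  exists_eq_iSup f := by
    obtain ⟨E, hE⟩ := f.2
    refine ⟨E, Subtype.ext ?_⟩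
    rw [hE, coe_iSup]
    simp only [coe_iSup]
    rfl

end LowerFun

end StepFunctions

theorem exists_nnRatNum (q : ℚ≥0) : ∃ n, nnRatNum n = (q : ℝ≥0) := by
  refine ⟨Nat.pair q.num (q.den - 1), ?_⟩
  have h : 1 ≤ q.den := q.den_pos
  have h2 : ((q.den - 1 : ℕ) : ℝ≥0) + 1 = (q.den : ℝ≥0) := by
    exact_mod_cast congrArg (Nat.cast (R := ℝ≥0)) (Nat.sub_add_cancel h)
  simp only [nnRatNum, Nat.unpair_pair, h2]
  exact (NNRat.cast_def q).symm

/-- `[0, ∞]` with the nonnegative rationals as an enumerative lattice. -/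
def ennrealLattice : EnumerativeLattice ℝ≥0∞ where
  elem n := (nnRatNum n : ℝ≥0∞)
  exists_eq_iSup y := by
    refine ⟨{n | (nnRatNum n : ℝ≥0∞) ≤ y}, le_antisymm ?_ (iSup₂_le fun n hn => hn)⟩
    refine le_of_forall_lt fun a ha => ?_
    obtain ⟨q, hq, haq, hqy⟩ := ENNReal.lt_iff_exists_rat_btwn.1 ha
    obtain ⟨n, hn⟩ := exists_nnRatNum ⟨q, hq⟩
    have h : (Real.toNNReal (q : ℝ)) = nnRatNum n := by
      rw [hn]
      apply NNReal.coe_injective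
      rw [Real.coe_toNNReal _ (by exact_mod_cast hq)]
      rfl
    rw [h] at haq hqy
    exact haq.trans_le (le_iSup₂_of_le n hqy.le le_rfl)

section WeightedSum

variable {X : Type*} [MeasurableSpace X]

/-- The measure `∑ (w + 1) δ_{s_i}` over the pairs `(i, w)` of a list. -/
def weightedSum (s : ℕ → X) : List (ℕ × ℕ) → Measure X
  | [] => 0
  | a :: l => ((a.2 : ℝ≥0∞) + 1) • Measure.dirac (s a.1) + weightedSum s l

/-- The nonempty list of pairs (index of an ideal point, weight) with code `n`. -/
def weightList (n : ℕ) : List (ℕ × ℕ) :=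
  n.unpair.1.unpair :: Denumerable.ofNat (List (ℕ × ℕ)) n.unpair.2

theorem weightedSum_univ_ne_top (s : ℕ → X) (l : List (ℕ × ℕ)) :
    weightedSum s l Set.univ ≠ ⊤ := by
  induction l with
  | nil => simp [weightedSum]
  | cons a l ih => simp [weightedSum, ih]

theorem weightedSum_univ_ne_zero (s : ℕ → X) (n : ℕ) :
    weightedSum s (weightList n) Set.univ ≠ 0 := by
  simp [weightedSum, weightList]

end WeightedSum

section Measures

variable {X : Type*} [MetricSpace X] [CompleteSpace X] [MeasurableSpace X] [BorelSpace X]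

/-- The numbering of the ideal measures, the probability measures which are concentrated on
finitely many ideal points and give them rational weights. The code `n` lists points `s_i` with
positive integer weights `w + 1`, which are divided by their sum. -/
def idealMeasure (S : ComputableMetricSpace X) (n : ℕ) :
    LevyProkhorov (ProbabilityMeasure X) :=
  LevyProkhorov.ofMeasure
    ⟨(weightedSum S.ideal (weightList n) Set.univ)⁻¹ • weightedSum S.ideal (weightList n),
      ⟨by
        rw [Measure.smul_apply, smul_eq_mul]
        exact ENNReal.inv_mul_cancel (weightedSum_univ_ne_zero _ _)
          (weightedSum_univ_ne_top _ _)⟩⟩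

/-- A uniform randomness test: a constructive function `T` from the probability measures, with the
Prokhorov metric and the ideal measures, to `𝒞(X, [0, ∞])` such that `∫ T μ dμ ≤ 1` for all `μ`. -/
structure IsUniformTest (S : ComputableMetricSpace X)
    (T : LevyProkhorov (ProbabilityMeasure X) → LowerFun S ennrealLattice) : Prop where
  constructive :
    IsConstructive (idealMeasure S) (LowerFun.enumerativeLattice S ennrealLattice) T
  lintegral_le_one : ∀ μ : LevyProkhorov (ProbabilityMeasure X),
    ∫⁻ x, T μ x ∂(μ.toMeasure : Measure X) ≤ 1

end Measures

end CompMetric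

end

-- A test `T` is given by a recursive `F` on prefixes. If `F` lists a step function after reading a
-- prefix of a name that ends in `b`, then every measure close enough to the ideal measure `b` has a
-- name with this prefix, so the step function lies below `T μ` for all these `μ`. Hence, up to
-- rounding, `T` is a supremum of atoms, each made of a ball of measures and a step function on `X`.
-- Every code `c` of a partial recursive function yields an enumeration of atoms, whether or not it
-- computes a test (`exists_atoms`). The universal test is a weighted supremum of all these
-- enumerations, each trimmed so that its integral is at most 2.
--
-- Trimming keeps the atom `i` at `μ` when the maximum (`cap`) of the atoms up to `i` that concern
-- `μ` has `μ`-integral below 2. Closed balls are used here, both in `X` and in the space of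
-- measures, so that the integral is upper semicontinuous in `μ` and the condition is open. A name
-- of `μ` then confirms it through a finite certificate at a nearby ideal measure
-- (`TrimCertificate.mem_trimmed`, `exists_trimCertificate`). Certificates can be searched for
-- because strict comparisons of Prokhorov distances between ideal measures with rationals are
-- semidecidable in both directions, and they are sound because a small Prokhorov distance controls
-- integrals of bounded integer-valued functions (`lintegral_natCast_le_of_dist_lt`).
--
-- By monotone convergence the kept atoms have a supremum of integral at most 2. If `c` computes a
-- test, all its atoms lie below that test, the integrals stay at most 1, and nothing is cut; the
-- gap between 1 and 2 allows the strict inequality. Atoms have natural numbers as values, and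
-- rounding down loses at most 1, which is paid for by the constant 1/2 included in the universal
-- test. With weights `2 ^ (-(c + 3))` the total integral is at most 1/2 + 1/2.

-- Closure properties of primitive recursive functions and predicates

attribute [fun_prop] Primrec
attribute [fun_prop] Primrec.id Primrec.const Primrec.comp Primrec.pair Primrec.fst Primrec.snd
attribute [fun_prop] Primrec.unpair Primrec.list_length Primrec.list_range Primrec.optionToList
attribute [fun_prop] Primrec.ofNat Primrec.option_some

namespace CompMetric

section PrimrecComposition

variable {α β : Type*} [Primcodable α] [Primcodable β]

@[fun_prop]
theorem primrec_add {f g : α → ℕ} (hf : Primrec f) (hg : Primrec g) :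
    Primrec fun a => f a + g a :=
  Primrec.nat_add.comp hf hg

@[fun_prop]
theorem primrec_sub {f g : α → ℕ} (hf : Primrec f) (hg : Primrec g) :
    Primrec fun a => f a - g a :=
  Primrec.nat_sub.comp hf hg

@[fun_prop]
theorem primrec_mul {f g : α → ℕ} (hf : Primrec f) (hg : Primrec g) :
    Primrec fun a => f a * g a :=
  Primrec.nat_mul.comp hf hg

@[fun_prop]
theorem primrec_pow {f g : α → ℕ} (hf : Primrec f) (hg : Primrec g) :
    Primrec fun a => f a ^ g a :=
  (Primrec₂.unpaired'.1 Nat.Primrec.pow).comp hf hg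

@[fun_prop]
theorem primrec_natPair {f g : α → ℕ} (hf : Primrec f) (hg : Primrec g) :
    Primrec fun a => Nat.pair (f a) (g a) :=
  Primrec₂.natPair.comp hf hg

@[fun_prop]
theorem primrec_cons {f : α → β} {g : α → List β} (hf : Primrec f) (hg : Primrec g) :
    Primrec fun a => f a :: g a :=
  Primrec.list_cons.comp hf hg

@[fun_prop]
theorem primrec_append {f g : α → List β} (hf : Primrec f) (hg : Primrec g) :
    Primrec fun a => f a ++ g a :=
  Primrec.list_append.comp hf hg

@[fun_prop]
theorem primrec_getElem? {f : α → List β} {g : α → ℕ} (hf : Primrec f) (hg : Primrec g) :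
    Primrec fun a => (f a)[g a]? :=
  Primrec.list_getElem?.comp hf hg

@[fun_prop]
theorem primrec_take {f : α → List β} {g : α → ℕ} (hf : Primrec f) (hg : Primrec g) :
    Primrec fun a => (f a).take (g a) :=
  Primrec.list_take.comp hg hf

@[fun_prop]
theorem primrec_encode {f : α → β} (hf : Primrec f) : Primrec fun a => Encodable.encode (f a) :=
  Primrec.encode.comp hf

@[fun_prop]
theorem primrec_decode {f : α → ℕ} (hf : Primrec f) :
    Primrec fun a => (Encodable.decode (f a) : Option β) :=
  Primrec.decode.comp hf

@[fun_prop]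
theorem primrec_evaln {f : α → ℕ} {g : α → Nat.Partrec.Code} {h : α → ℕ} (hf : Primrec f)
    (hg : Primrec g) (hh : Primrec h) :
    Primrec fun a => Nat.Partrec.Code.evaln (f a) (g a) (h a) :=
  Nat.Partrec.Code.primrec_evaln.comp ((hf.pair hg).pair hh)

theorem primrecPred_eq {f g : α → β} (hf : Primrec f) (hg : Primrec g) :
    PrimrecPred fun a => f a = g a :=
  Primrec.eq.comp hf hg

theorem primrecPred_lt {f g : α → ℕ} (hf : Primrec f) (hg : Primrec g) :
    PrimrecPred fun a => f a < g a :=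
  Primrec.nat_lt.comp hf hg

theorem primrecPred_le {f g : α → ℕ} (hf : Primrec f) (hg : Primrec g) :
    PrimrecPred fun a => f a ≤ g a :=
  Primrec.nat_le.comp hf hg

theorem primrecPred_exists_mem {p : α × β → Prop} {l : α → List β} (hp : PrimrecPred p)
    (hl : Primrec l) : PrimrecPred fun a => ∃ b ∈ l a, p (a, b) := by
  have h : PrimrecRel fun (b : β) (a : α) => p (a, b) :=
    hp.comp (f := fun x : β × α => (x.2, x.1)) (by fun_prop)
  exact h.exists_mem_list.comp hl Primrec.id

theorem primrecPred_forall_mem {p : α × β → Prop} {l : α → List β} (hp : PrimrecPred p)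
    (hl : Primrec l) : PrimrecPred fun a => ∀ b ∈ l a, p (a, b) := by
  have h : PrimrecRel fun (b : β) (a : α) => p (a, b) :=
    hp.comp (f := fun x : β × α => (x.2, x.1)) (by fun_prop)
  exact h.forall_mem_list.comp hl Primrec.id

theorem primrecPred_mem {f : α → β} {l : α → List β} (hf : Primrec f) (hl : Primrec l) :
    PrimrecPred fun a => f a ∈ l a :=
  (primrecPred_exists_mem (p := fun x : α × β => f x.1 = x.2)
    (primrecPred_eq (by fun_prop) (by fun_prop)) hl).of_eq fun a => by simp

@[fun_prop]
theorem primrec_sublists' {f : α → List β} (hf : Primrec f) : Primrec fun a => (f a).sublists' := by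
  have h : Primrec₂ fun (_ : α) (x : β × List (List β)) => x.2 ++ x.2.map (List.cons x.1) :=
    Primrec.list_append.comp (Primrec.snd.comp Primrec.snd)
      (Primrec.list_map (Primrec.snd.comp Primrec.snd)
        (Primrec.list_cons.comp (Primrec.fst.comp (Primrec.snd.comp Primrec.fst)) Primrec.snd))
  refine (Primrec.list_foldr hf (Primrec.const [[]]) h).of_eq fun a => ?_
  induction f a with
  | nil => rfl
  | cons b l ih => simp only [List.foldr_cons, ih, List.sublists'_cons]

end PrimrecComposition

/-! ### Semidecidable predicates and recursive operators -/

/-- A semidecidable predicate: the projection of a primitive recursive one. -/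
def SemiDec {α : Type*} [Primcodable α] (p : α → Prop) : Prop :=
  ∃ r : α × ℕ → Prop, PrimrecPred r ∧ ∀ a, p a ↔ ∃ n, r (a, n)

namespace SemiDec

variable {α β : Type*} [Primcodable α] [Primcodable β] {p q : α → Prop}

theorem of_primrecPred (h : PrimrecPred p) : SemiDec p :=
  ⟨fun x => p x.1, h.comp Primrec.fst, fun a => by simp⟩

theorem of_iff (hp : SemiDec p) (h : ∀ a, q a ↔ p a) : SemiDec q := by
  rwa [funext fun a => propext (h a)]

theorem comp {p : β → Prop} {f : α → β} (hp : SemiDec p) (hf : Primrec f) :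
    SemiDec fun a => p (f a) := by
  obtain ⟨r, hr, h⟩ := hp
  exact ⟨fun x => r (f x.1, x.2), hr.comp (by fun_prop), fun a => h (f a)⟩

theorem and (hp : SemiDec p) (hq : SemiDec q) : SemiDec fun a => p a ∧ q a := by
  obtain ⟨r, hr, h⟩ := hp
  obtain ⟨s, hs, h'⟩ := hq
  refine ⟨fun x => r (x.1, x.2.unpair.1) ∧ s (x.1, x.2.unpair.2),
    (hr.comp (by fun_prop)).and (hs.comp (by fun_prop)), fun a => ?_⟩
  simp only [h, h']
  constructor
  · rintro ⟨⟨m, hm⟩, n, hn⟩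
    exact ⟨Nat.pair m n, by simpa using ⟨hm, hn⟩⟩
  · rintro ⟨n, h1, h2⟩
    exact ⟨⟨_, h1⟩, _, h2⟩

theorem or (hp : SemiDec p) (hq : SemiDec q) : SemiDec fun a => p a ∨ q a := by
  obtain ⟨r, hr, h⟩ := hp
  obtain ⟨s, hs, h'⟩ := hq
  exact ⟨fun x => r x ∨ s x, hr.or hs, fun a => by simp only [h, h', exists_or]⟩

theorem exists_ {p : α → β → Prop} (hp : SemiDec fun x : α × β => p x.1 x.2) :
    SemiDec fun a => ∃ b, p a b := by
  obtain ⟨r, hr, h⟩ := hp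
  refine ⟨fun x => ∃ b ∈ (Encodable.decode x.2.unpair.1 : Option β).toList,
    r ((x.1, b), x.2.unpair.2), ?_, fun a => ?_⟩
  · exact primrecPred_exists_mem (p := fun y : (α × ℕ) × β => r ((y.1.1, y.2), y.1.2.unpair.2))
      (hr.comp (by fun_prop)) (by fun_prop)
  · constructor
    · rintro ⟨b, hb⟩
      obtain ⟨n, hn⟩ := (h (a, b)).1 hb
      exact ⟨Nat.pair (Encodable.encode b) n, b, by simp, by simpa using hn⟩
    · rintro ⟨n, b, -, hn⟩
      exact ⟨b, (h (a, b)).2 ⟨_, hn⟩⟩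

theorem forall_mem {p : α → β → Prop} {l : α → List β} (hp : SemiDec fun x : α × β => p x.1 x.2)
    (hl : Primrec l) : SemiDec fun a => ∀ b ∈ l a, p a b := by
  obtain ⟨r, hr, h⟩ := hp
  refine ⟨fun x => ∀ b ∈ l x.1, ∃ n ∈ List.range x.2, r ((x.1, b), n), ?_, fun a => ?_⟩
  · refine primrecPred_forall_mem
      (p := fun y : (α × ℕ) × β => ∃ n ∈ List.range y.1.2, r ((y.1.1, y.2), n)) ?_ (by fun_prop)
    exact primrecPred_exists_mem (p := fun y : ((α × ℕ) × β) × ℕ => r ((y.1.1.1, y.1.2), y.2))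
      (hr.comp (by fun_prop)) (by fun_prop)
  -- Finitely many witnesses have a common bound, and the search below that bound is primitive
  -- recursive.
  · simp only [List.mem_range, fun b => h (a, b)]
    generalize l a = L
    constructor
    · intro H
      induction L with
      | nil => exact ⟨0, by simp⟩
      | cons b L ih =>
        obtain ⟨N, hN⟩ := ih fun b' hb' => H b' (List.mem_cons_of_mem _ hb')
        obtain ⟨n, hn⟩ := H b List.mem_cons_self
        refine ⟨max N (n + 1), fun b' hb' => ?_⟩
        rcases List.mem_cons.1 hb' with rfl | hb'
        · exact ⟨n, by omega, hn⟩
        · obtain ⟨m, hm, hm'⟩ := hN b' hb'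
          exact ⟨m, by omega, hm'⟩
    · rintro ⟨N, hN⟩ b hb
      obtain ⟨n, -, hn⟩ := hN b hb
      exact ⟨n, hn⟩

theorem exists_mem {p : α → β → Prop} {l : α → List β} (hp : SemiDec fun x : α × β => p x.1 x.2)
    (hl : Primrec l) : SemiDec fun a => ∃ b ∈ l a, p a b :=
  exists_ ((of_primrecPred (primrecPred_mem (by fun_prop) (by fun_prop))).and hp)

theorem forall_lt {p : α → ℕ → Prop} {f : α → ℕ} (hp : SemiDec fun x : α × ℕ => p x.1 x.2)
    (hf : Primrec f) : SemiDec fun a => ∀ n < f a, p a n :=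
  (forall_mem (l := fun a => List.range (f a)) hp (by fun_prop)).of_iff fun a => by simp

end SemiDec

theorem exists_code_of_computable {α β : Type*} [Primcodable α] [Primcodable β] {f : α → β}
    (hf : Computable f) :
    ∃ c : Nat.Partrec.Code, ∀ a, c.eval (Encodable.encode a) = Part.some (Encodable.encode (f a)) := by
  obtain ⟨c, hc⟩ := Nat.Partrec.Code.exists_code.1 hf
  exact ⟨c, fun a => by rw [hc]; simp⟩

theorem exists_evaln_eq_iff {c : Nat.Partrec.Code} {n m m' : ℕ} (h : c.eval n = Part.some m) :
    (∃ k, c.evaln k n = some m') ↔ m' = m := by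
  have := @Nat.Partrec.Code.evaln_complete c n m'
  rw [h] at this
  simpa using this.symm

/-- Since `f` need not be primitive recursive, its value is guessed together with a number of steps
after which a code of `f` returns it. -/
theorem SemiDec.comp_computable {α β : Type*} [Primcodable α] [Primcodable β] {p : β → Prop}
    {f : α → β} (hp : SemiDec p) (hf : Computable f) : SemiDec fun a => p (f a) := by
  obtain ⟨c, hc⟩ := exists_code_of_computable hf
  have h : SemiDec fun a : α => ∃ b : β, (∃ k : ℕ, c.evaln k (Encodable.encode a) =
      some (Encodable.encode b)) ∧ p b := by
    refine SemiDec.exists_ (SemiDec.and (SemiDec.exists_ (SemiDec.of_primrecPred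
      (primrecPred_eq (by fun_prop) (by fun_prop)))) (hp.comp Primrec.snd))
  refine h.of_iff fun a => ?_
  simp only [exists_evaln_eq_iff (hc a), Encodable.encode_inj]
  simp

/-- A semidecidable set of pairs (prefix, value) is enumerated by a recursive operator. -/
theorem exists_recursiveOperator {P : List ℕ × ℕ → Prop} (hP : SemiDec P) :
    ∃ F, IsRecursiveOperator F ∧
      ∀ σ, operatorOutput F σ = {m | ∃ k, P ((List.range k).map σ, m)} := by
  classical
  obtain ⟨r, hr, h⟩ := hP
  -- Stage `k` looks only at the first `k` entries and at witnesses below `k`. Extending the input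
  -- therefore leaves the earlier stages unchanged and appends new ones, which gives monotonicity.
  let R : (ℕ × List ℕ) → ℕ → Prop := fun x m =>
    ∃ j ∈ List.range (x.1 + 1), ∃ i ∈ List.range x.1, r ((x.2.take j, m), i)
  have hR : PrimrecRel fun (m : ℕ) (x : ℕ × List ℕ) => R x m := by
    refine primrecPred_exists_mem (p := fun y : (ℕ × ℕ × List ℕ) × ℕ =>
      ∃ i ∈ List.range y.1.2.1, r ((y.1.2.2.take y.2, y.1.1), i)) ?_ (by fun_prop)
    exact primrecPred_exists_mem (p := fun y : ((ℕ × ℕ × List ℕ) × ℕ) × ℕ =>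
      r ((y.1.1.2.2.take y.1.2, y.1.1.1), y.2)) (hr.comp (by fun_prop)) (by fun_prop)
  let g : ℕ × List ℕ → List ℕ := fun x => (List.range x.1).filter fun m => R x m
  have hg : Primrec g := hR.listFilter.comp (by fun_prop) Primrec.id
  refine ⟨fun u => (List.range (u.length + 1)).flatMap fun k => g (k, u), ⟨?_, ?_⟩, ?_⟩
  · exact (Primrec.list_flatMap (g := fun u k => g (k, u)) (by fun_prop)
      (hg.comp (Primrec.snd.pair Primrec.fst))).to_comp
  · rintro u v ⟨w, rfl⟩
    have h1 : ∀ k ∈ List.range (u.length + 1), g (k, u ++ w) = g (k, u) := by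
      intro k hk
      refine List.filter_congr fun m _ => ?_
      have : R (k, u ++ w) m ↔ R (k, u) m := by
        simp only [R, List.mem_range] at hk ⊢
        refine exists_congr fun j => and_congr_right fun hj => ?_
        rw [List.take_append_of_le_length (by omega)]
      simp [this]
    have h2 : (u ++ w).length + 1 = (u.length + 1) + w.length := by simp; omega
    rw [h2, List.range_add (n := u.length + 1), List.flatMap_append, List.flatMap_congr h1]
    exact List.prefix_append _ _
  · intro σ
    ext m
    simp only [operatorOutput, Set.mem_ofPred_eq, List.mem_flatMap, g, List.mem_filter, R,
      List.mem_range, h, decide_eq_true_eq, List.length_map, List.length_range, ← List.map_take,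
      List.take_range]
    constructor
    · rintro ⟨k, k', hk', hm, j, hj, i, hi, H⟩
      exact ⟨_, i, H⟩
    · rintro ⟨k, i, H⟩
      refine ⟨k + i + m + 1, k + i + m + 1, by omega, by omega, k, by omega, i, by omega, ?_⟩
      rwa [min_eq_left (by omega)]

theorem IsCauchyName.dist_lt {X : Type*} [PseudoMetricSpace X] {s : ℕ → X} {σ : ℕ → ℕ} {x : X}
    (h : IsCauchyName s σ x) (n : ℕ) : dist (s (σ n)) x < 2 * (1 / 2 : ℝ) ^ n := by
  have h1 := dist_le_of_le_geometric_of_tendsto (1 / 2 : ℝ) 1 (by norm_num)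
    (fun k => by simpa using (h.1 k).le) h.2 (n + 1)
  have h2 := h.1 n
  have h3 := dist_triangle (s (σ n)) (s (σ (n + 1))) x
  rw [pow_succ] at h1
  norm_num at h1 h2 ⊢
  linarith

/-! ### Semidecidable comparison of distances between ideal points -/

section Distances

variable {X : Type*} [MetricSpace X] [CompleteSpace X] (S : ComputableMetricSpace X)

/-- Clearing denominators leaves a comparison of natural numbers, which is primitive recursive. -/
theorem ratNum_add_mul_lt_iff (q n A B : ℕ) :
    (ratNum q + 2 * (1 / 2 : ℝ) ^ n) * B < A ↔
      (q.unpair.1.unpair.1 * 2 ^ n + 2 * (q.unpair.2 + 1)) * B <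
        A * (q.unpair.2 + 1) * 2 ^ n + q.unpair.1.unpair.2 * 2 ^ n * B := by
  have h : (0 : ℝ) < (q.unpair.2 + 1) * 2 ^ n := by positivity
  have h1 : (0 : ℝ) < q.unpair.2 + 1 := by positivity
  rw [← mul_lt_mul_iff_left₀ h, ← Nat.cast_lt (α := ℝ), ratNum]
  push_cast
  have e : ((((q.unpair.1.unpair.1 : ℝ) - q.unpair.1.unpair.2) / (q.unpair.2 + 1) +
      2 * (1 / 2) ^ n) * B) * ((q.unpair.2 + 1) * 2 ^ n) =
      ((q.unpair.1.unpair.1 : ℝ) * 2 ^ n + 2 * (q.unpair.2 + 1)) * B -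
        q.unpair.1.unpair.2 * 2 ^ n * B := by
    rw [one_div, inv_pow]
    field_simp
    ring
  rw [e]
  constructor <;> intro h <;> linarith

theorem lt_ratNum_sub_mul_iff (q n A B : ℕ) :
    A < (ratNum q - 2 * (1 / 2 : ℝ) ^ n) * B ↔
      A * (q.unpair.2 + 1) * 2 ^ n + q.unpair.1.unpair.2 * 2 ^ n * B + 2 * (q.unpair.2 + 1) * B <
        q.unpair.1.unpair.1 * 2 ^ n * B := by
  have h : (0 : ℝ) < (q.unpair.2 + 1) * 2 ^ n := by positivity
  have h1 : (0 : ℝ) < q.unpair.2 + 1 := by positivity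
  rw [← mul_lt_mul_iff_left₀ h, ← Nat.cast_lt (α := ℝ), ratNum]
  push_cast
  have e : ((((q.unpair.1.unpair.1 : ℝ) - q.unpair.1.unpair.2) / (q.unpair.2 + 1) -
      2 * (1 / 2) ^ n) * B) * ((q.unpair.2 + 1) * 2 ^ n) =
      ((q.unpair.1.unpair.1 : ℝ) * 2 ^ n - 2 * (q.unpair.2 + 1)) * B -
        q.unpair.1.unpair.2 * 2 ^ n * B := by
    rw [one_div, inv_pow]
    field_simp
    ring
  rw [e]
  constructor <;> intro h <;> linarith

theorem tendsto_two_mul_half_pow : Tendsto (fun n : ℕ => 2 * (1 / 2 : ℝ) ^ n) atTop (𝓝 0) := by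
  simpa using (tendsto_pow_atTop_nhds_zero_of_lt_one (r := (1 / 2 : ℝ)) (by norm_num)
    (by norm_num)).const_mul 2

/-- The `n`-th term of a name has error below `2 * 2 ^ (-n)`, so a strict inequality becomes visible
at some finite precision. -/
theorem IsCauchyName.mul_lt_iff {σ : ℕ → ℕ} {d : ℝ} (h : IsCauchyName ratNum σ d) (A B : ℕ) :
    d * B < A ↔ ∃ n, (ratNum (σ n) + 2 * (1 / 2 : ℝ) ^ n) * B < A := by
  constructor
  · intro hd
    have h1 : Tendsto (fun n => (ratNum (σ n) + 2 * (1 / 2 : ℝ) ^ n) * B) atTop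
        (𝓝 ((d + 0) * B)) := (h.2.add tendsto_two_mul_half_pow).mul_const _
    rw [add_zero] at h1
    exact (h1.eventually_lt_const hd).exists
  · rintro ⟨n, hn⟩
    refine lt_of_le_of_lt (mul_le_mul_of_nonneg_right ?_ (Nat.cast_nonneg _)) hn
    have := abs_lt.1 (h.dist_lt n)
    linarith

theorem IsCauchyName.lt_mul_iff {σ : ℕ → ℕ} {d : ℝ} (h : IsCauchyName ratNum σ d) (A B : ℕ) :
    A < d * B ↔ ∃ n, A < (ratNum (σ n) - 2 * (1 / 2 : ℝ) ^ n) * B := by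
  constructor
  · intro hd
    have h1 : Tendsto (fun n => (ratNum (σ n) - 2 * (1 / 2 : ℝ) ^ n) * B) atTop
        (𝓝 ((d - 0) * B)) := (h.2.sub tendsto_two_mul_half_pow).mul_const _
    rw [sub_zero] at h1
    exact (h1.eventually_const_lt hd).exists
  · rintro ⟨n, hn⟩
    refine lt_of_lt_of_le hn (mul_le_mul_of_nonneg_right ?_ (Nat.cast_nonneg _))
    have := abs_lt.1 (h.dist_lt n)
    linarith

theorem computable_distArgs {f : ℕ × ℕ × ℕ → ℕ} (hf : Computable f) :
    Computable fun x : ((ℕ × ℕ) × ℕ × ℕ) × ℕ => (f (x.1.1.1, x.1.1.2, x.2), x.2, x.1.2) :=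
  (hf.comp (show Primrec fun x : ((ℕ × ℕ) × ℕ × ℕ) × ℕ => (x.1.1.1, x.1.1.2, x.2) by
    fun_prop).to_comp).pair (show Primrec fun x : ((ℕ × ℕ) × ℕ × ℕ) × ℕ => (x.2, x.1.2) by
    fun_prop).to_comp

theorem semiDec_dist_mul_lt : SemiDec fun x : (ℕ × ℕ) × ℕ × ℕ =>
    dist (S.ideal x.1.1) (S.ideal x.1.2) * x.2.2 < x.2.1 := by
  obtain ⟨f, hf, h⟩ := S.dist_computable
  have h0 : SemiDec fun y : ℕ × ℕ × ℕ × ℕ =>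
      (ratNum y.1 + 2 * (1 / 2 : ℝ) ^ y.2.1) * y.2.2.2 < y.2.2.1 := by
    simp only [ratNum_add_mul_lt_iff]
    exact .of_primrecPred (primrecPred_lt (by fun_prop) (by fun_prop))
  exact (SemiDec.exists_ (h0.comp_computable (computable_distArgs hf))).of_iff fun x =>
    (h _ _).mul_lt_iff _ _

theorem semiDec_lt_dist_mul : SemiDec fun x : (ℕ × ℕ) × ℕ × ℕ =>
    x.2.1 < dist (S.ideal x.1.1) (S.ideal x.1.2) * x.2.2 := by
  obtain ⟨f, hf, h⟩ := S.dist_computable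
  have h0 : SemiDec fun y : ℕ × ℕ × ℕ × ℕ =>
      y.2.2.1 < (ratNum y.1 - 2 * (1 / 2 : ℝ) ^ y.2.1) * y.2.2.2 := by
    simp only [lt_ratNum_sub_mul_iff]
    exact .of_primrecPred (primrecPred_lt (by fun_prop) (by fun_prop))
  exact (SemiDec.exists_ (h0.comp_computable (computable_distArgs hf))).of_iff fun x =>
    (h _ _).lt_mul_iff _ _

end Distances

/-! ### Inequalities for the Prokhorov metric -/

section Prokhorov

variable {X : Type*} [MetricSpace X] [MeasurableSpace X] [BorelSpace X]

/-- For measures of equal mass a one-sided bound suffices: applied to the complement of a thickening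
of `A`, it gives the bound for `A` with the two measures exchanged. -/
theorem dist_le_of_forall_measureReal_le {μ ν : LevyProkhorov (ProbabilityMeasure X)} {δ : ℝ}
    (hδ : 0 ≤ δ) (h : ∀ B, MeasurableSet B →
      (μ.toMeasure : Measure X).real B ≤
        (ν.toMeasure : Measure X).real (Metric.thickening δ B) + δ) :
    dist μ ν ≤ δ := by
  rw [LevyProkhorov.dist_probabilityMeasure_def]
  refine levyProkhorovDist_le_of_forall_le _ _ hδ fun ε B hε hB => ?_
  have h1 := (h B hB).trans (add_le_add
    (measureReal_mono (μ := (ν.toMeasure : Measure X)) (Metric.thickening_mono hε.le B)) hε.le)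
  rw [← ofReal_measureReal, ← ofReal_measureReal (s := Metric.thickening ε B),
    ← ENNReal.ofReal_add measureReal_nonneg (hδ.trans hε.le)]
  exact ENNReal.ofReal_le_ofReal h1

theorem measure_le_of_dist_lt {μ ν : LevyProkhorov (ProbabilityMeasure X)} {δ : ℝ}
    (h : dist μ ν < δ) {B : Set X} (hB : MeasurableSet B) :
    (μ.toMeasure : Measure X) B ≤
      (ν.toMeasure : Measure X) (Metric.thickening δ B) + ENNReal.ofReal δ := by
  have hδ : 0 ≤ δ := dist_nonneg.trans h.le
  have h1 : levyProkhorovEDist (μ.toMeasure : Measure X) (ν.toMeasure : Measure X) <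
      ENNReal.ofReal δ := by
    have h2 := edist_dist μ ν
    rw [LevyProkhorov.edist_probabilityMeasure_def] at h2
    exact h2.trans_lt ((ENNReal.ofReal_lt_ofReal_iff (dist_nonneg.trans_lt h)).2 h)
  simpa [ENNReal.toReal_ofReal hδ] using left_measure_le_of_levyProkhorovEDist_lt h1 hB

theorem measureReal_le_of_dist_lt {μ ν : LevyProkhorov (ProbabilityMeasure X)} {δ : ℝ}
    (h : dist μ ν < δ) {B : Set X} (hB : MeasurableSet B) :
    (μ.toMeasure : Measure X).real B ≤
      (ν.toMeasure : Measure X).real (Metric.thickening δ B) + δ := by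
  have hδ : 0 ≤ δ := dist_nonneg.trans h.le
  have h1 := measure_le_of_dist_lt h hB
  rw [← ofReal_measureReal, ← ofReal_measureReal (s := Metric.thickening δ B),
    ← ENNReal.ofReal_add measureReal_nonneg hδ] at h1
  exact (ENNReal.ofReal_le_ofReal_iff (add_nonneg measureReal_nonneg hδ)).1 h1

end Prokhorov

/-! ### Ideal measures as weighted lists -/

/-- The total weight of a list of pairs (index, weight). -/
def totalWeight (l : List (ℕ × ℕ)) : ℕ := (l.map fun e => e.2 + 1).sum

@[fun_prop]
theorem primrec_totalWeight {α : Type*} [Primcodable α] {f : α → List (ℕ × ℕ)} (hf : Primrec f) :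
    Primrec fun a => totalWeight (f a) := by
  refine (Primrec.list_foldr (h := fun (_ : α) (x : (ℕ × ℕ) × ℕ) => x.1.2 + 1 + x.2) hf
    (Primrec.const 0) ?_).of_eq fun a => ?_
  · show Primrec fun y : α × (ℕ × ℕ) × ℕ => y.2.1.2 + 1 + y.2.2
    fun_prop
  · unfold totalWeight
    induction f a with
    | nil => rfl
    | cons b l ih => simp only [List.foldr_cons, ih, List.map_cons, List.sum_cons]

@[fun_prop]
theorem primrec_weightList {α : Type*} [Primcodable α] {f : α → ℕ} (hf : Primrec f) :
    Primrec fun a => weightList (f a) := by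
  unfold weightList
  fun_prop

theorem totalWeight_le_of_sublist {l l' : List (ℕ × ℕ)} (h : l.Sublist l') :
    totalWeight l ≤ totalWeight l' :=
  (h.map _).sum_le_sum fun _ _ => Nat.zero_le _

theorem totalWeight_weightList_pos (n : ℕ) : 0 < totalWeight (weightList n) := by
  simp [totalWeight, weightList]

section IdealMeasures

variable {X : Type*} [MeasurableSpace X]

theorem lintegral_weightedSum [MeasurableSingletonClass X] (s : ℕ → X) (l : List (ℕ × ℕ))
    (f : X → ℝ≥0∞) :
    ∫⁻ x, f x ∂weightedSum s l = (l.map fun e => ((e.2 : ℝ≥0∞) + 1) * f (s e.1)).sum := by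
  induction l with
  | nil => simp [weightedSum]
  | cons a l ih => simp [weightedSum, lintegral_add_measure, lintegral_smul_measure, ih]

theorem weightedSum_apply [MeasurableSingletonClass X] (s : ℕ → X) (l : List (ℕ × ℕ)) (A : Set X)
    [DecidablePred (· ∈ A)] :
    weightedSum s l A = totalWeight (l.filter fun e => s e.1 ∈ A) := by
  induction l with
  | nil => simp [weightedSum, totalWeight]
  | cons a l ih =>
    by_cases h : s a.1 ∈ A <;> simp [weightedSum, ih, h, totalWeight]

theorem weightedSum_univ (s : ℕ → X) (l : List (ℕ × ℕ)) :
    weightedSum s l Set.univ = totalWeight l := by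
  induction l with
  | nil => simp [weightedSum, totalWeight]
  | cons a l ih => simp [weightedSum, ih, totalWeight]

end IdealMeasures

section IdealMeasures

variable {X : Type*} [MetricSpace X] [CompleteSpace X] [MeasurableSpace X] [BorelSpace X]
  (S : ComputableMetricSpace X)

theorem coe_idealMeasure (n : ℕ) : ((idealMeasure S n).toMeasure : Measure X) =
    (totalWeight (weightList n) : ℝ≥0∞)⁻¹ • weightedSum S.ideal (weightList n) := by
  rw [← weightedSum_univ S.ideal]
  rfl

theorem idealMeasure_real (n : ℕ) (A : Set X) [DecidablePred (· ∈ A)] :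
    ((idealMeasure S n).toMeasure : Measure X).real A =
      totalWeight ((weightList n).filter fun e => S.ideal e.1 ∈ A) /
        totalWeight (weightList n) := by
  rw [coe_idealMeasure, measureReal_def, Measure.smul_apply, weightedSum_apply]
  simp [div_eq_inv_mul]

theorem le_idealMeasure_real {n : ℕ} {A : Set X} {l : List (ℕ × ℕ)}
    (hl : l.Sublist (weightList n)) (h : ∀ e ∈ l, S.ideal e.1 ∈ A) :
    (totalWeight l : ℝ) / totalWeight (weightList n) ≤
      ((idealMeasure S n).toMeasure : Measure X).real A := by
  classical
  rw [idealMeasure_real]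
  gcongr
  refine totalWeight_le_of_sublist ?_
  rw [← List.filter_eq_self (p := fun e => decide (S.ideal e.1 ∈ A)) (l := l) |>.2 (by simpa using h)]
  exact hl.filter _

end IdealMeasures

/-! ### Semidecidable comparison of distances between ideal measures -/

theorem exists_nat_div_btwn {r r' : ℝ} (h0 : 0 ≤ r) (h : r < r') :
    ∃ x y : ℕ, 0 < y ∧ r < (x : ℝ) / y ∧ (x : ℝ) / y < r' := by
  obtain ⟨q, h1, h2⟩ := exists_rat_btwn h
  have hq : 0 ≤ q := by
    have : (0 : ℝ) < q := h0.trans_lt h1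
    exact_mod_cast this.le
  have e : (q : ℝ) = (q.num.toNat : ℝ) / (q.den : ℝ) := by
    have h3 : (q.num.toNat : ℤ) = q.num := Int.toNat_of_nonneg (Rat.num_nonneg.2 hq)
    have h4 : (q.num.toNat : ℝ) = (q.num : ℝ) := by exact_mod_cast congrArg (Int.cast (R := ℝ)) h3
    rw [h4, Rat.cast_def]
  exact ⟨q.num.toNat, q.den, q.den_pos, e ▸ h1, e ▸ h2⟩

section

variable {X : Type*} [MetricSpace X] [CompleteSpace X] [MeasurableSpace X] [BorelSpace X]
  (S : ComputableMetricSpace X)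

/-- Only the points that carry mass matter, so the Prokhorov condition has to be tested on the
finitely many sublists `C` only. Asking for some `D` near `C` of sufficient weight, instead of the
full thickening, keeps every distance comparison positive and strict. -/
theorem dist_idealMeasure_mul_lt_iff (a b A B : ℕ) :
    dist (idealMeasure S a) (idealMeasure S b) * B < A ↔
      ∃ z : ℕ × ℕ, (0 < z.2 ∧ z.1 * B < A * z.2) ∧
        ∀ C ∈ (weightList a).sublists', ∃ D ∈ (weightList b).sublists',
          (∀ e ∈ D, ∃ e' ∈ C, dist (S.ideal e'.1) (S.ideal e.1) * z.2 < z.1) ∧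
          totalWeight C * totalWeight (weightList b) * z.2 ≤
            totalWeight D * totalWeight (weightList a) * z.2 +
              z.1 * totalWeight (weightList a) * totalWeight (weightList b) := by
  classical
  have ha : (0 : ℝ) < totalWeight (weightList a) := by
    exact_mod_cast totalWeight_weightList_pos a
  have hb : (0 : ℝ) < totalWeight (weightList b) := by
    exact_mod_cast totalWeight_weightList_pos b
  have key : ∀ C D : List (ℕ × ℕ), ∀ x y : ℕ, 0 < y →
      (totalWeight C * totalWeight (weightList b) * y ≤
        totalWeight D * totalWeight (weightList a) * y +
          x * totalWeight (weightList a) * totalWeight (weightList b) ↔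
      (totalWeight C : ℝ) / totalWeight (weightList a) ≤
        totalWeight D / totalWeight (weightList b) + (x : ℝ) / y) := by
    intro C D x y hy
    have hy : (0 : ℝ) < y := by exact_mod_cast hy
    rw [← Nat.cast_le (α := ℝ), div_add_div _ _ hb.ne' hy.ne', div_le_div_iff₀ ha (by positivity)]
    push_cast
    constructor <;> intro h <;> linarith
  constructor
  · intro h
    have h1 : ∃ x y : ℕ, 0 < y ∧ dist (idealMeasure S a) (idealMeasure S b) < (x : ℝ) / y ∧
        (x : ℝ) / y * B < A := by
      rcases Nat.eq_zero_or_pos B with rfl | hB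
      · obtain ⟨x, y, hy, h2, -⟩ := exists_nat_div_btwn dist_nonneg
          (lt_add_one (dist (idealMeasure S a) (idealMeasure S b)))
        exact ⟨x, y, hy, h2, by simpa using h⟩
      · have hB : (0 : ℝ) < B := by exact_mod_cast hB
        obtain ⟨x, y, hy, h2, h3⟩ := exists_nat_div_btwn dist_nonneg ((lt_div_iff₀ hB).2 h)
        exact ⟨x, y, hy, h2, (lt_div_iff₀ hB).1 h3⟩
    obtain ⟨x, y, hy, h2, h3⟩ := h1
    have hy' : (0 : ℝ) < y := by exact_mod_cast hy
    refine ⟨(x, y), ⟨hy, ?_⟩, fun C hC => ?_⟩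
    · rw [div_mul_eq_mul_div, div_lt_iff₀ hy'] at h3
      exact_mod_cast h3
    · rw [List.mem_sublists'] at hC
      set K : Set X := {p | ∃ e ∈ C, S.ideal e.1 = p} with hK
      have hKm : MeasurableSet K := by
        have : K = (fun e : ℕ × ℕ => S.ideal e.1) '' {e | e ∈ C} := rfl
        rw [this]
        exact ((List.finite_toSet C).image _).measurableSet
      have h4 := measureReal_le_of_dist_lt h2 hKm
      refine ⟨(weightList b).filter fun e => S.ideal e.1 ∈ Metric.thickening ((x : ℝ) / y) K,
        List.mem_sublists'.2 List.filter_sublist, fun e he => ?_, ?_⟩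
      · obtain ⟨-, he⟩ := List.mem_filter.1 he
        obtain ⟨p, ⟨e', he', rfl⟩, h5⟩ := Metric.mem_thickening_iff.1 (of_decide_eq_true he)
        refine ⟨e', he', ?_⟩
        rw [dist_comm]
        exact (lt_div_iff₀ hy').1 h5
      · rw [key _ _ _ _ hy, ← idealMeasure_real]
        exact (le_idealMeasure_real S hC (A := K) fun e he => ⟨e, he, rfl⟩).trans h4
  · rintro ⟨⟨x, y⟩, ⟨hy, hxy⟩, h⟩
    dsimp only at hy hxy h
    have hy' : (0 : ℝ) < y := by exact_mod_cast hy
    have h1 : dist (idealMeasure S a) (idealMeasure S b) ≤ (x : ℝ) / y := by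
      refine dist_le_of_forall_measureReal_le (by positivity) fun K hK => ?_
      obtain ⟨D, hD, h2, h3⟩ := h ((weightList a).filter fun e => S.ideal e.1 ∈ K)
        (List.mem_sublists'.2 List.filter_sublist)
      rw [key _ _ _ _ hy, ← idealMeasure_real] at h3
      refine h3.trans ?_
      gcongr
      refine le_idealMeasure_real S (List.mem_sublists'.1 hD) fun e he => ?_
      obtain ⟨e', he', h4⟩ := h2 e he
      obtain ⟨-, he'⟩ := List.mem_filter.1 he'
      refine Metric.mem_thickening_iff.2 ⟨_, of_decide_eq_true he', ?_⟩
      rw [dist_comm]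
      exact (lt_div_iff₀ hy').2 h4
    refine (mul_le_mul_of_nonneg_right h1 (Nat.cast_nonneg B)).trans_lt ?_
    rw [div_mul_eq_mul_div, div_lt_iff₀ hy']
    exact_mod_cast hxy

/-- A large distance is witnessed by one set `C` that violates the Prokhorov inequality. The failure
is expressed by a list `D` of points far from `C`, which bounds the mass of the thickening from
above by that of the complement of `D`. -/
theorem lt_dist_idealMeasure_mul_iff (a b A B : ℕ) :
    A < dist (idealMeasure S a) (idealMeasure S b) * B ↔
      ∃ z : ℕ × ℕ, (0 < z.2 ∧ A * z.2 < z.1 * B) ∧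
        ∃ C ∈ (weightList a).sublists', ∃ D ∈ (weightList b).sublists',
          (∀ e ∈ D, ∀ e' ∈ C, z.1 < dist (S.ideal e'.1) (S.ideal e.1) * z.2) ∧
          totalWeight (weightList a) * totalWeight (weightList b) * z.2 +
              z.1 * totalWeight (weightList a) * totalWeight (weightList b) <
            totalWeight C * totalWeight (weightList b) * z.2 +
              totalWeight D * totalWeight (weightList a) * z.2 := by
  classical
  have ha : (0 : ℝ) < totalWeight (weightList a) := by
    exact_mod_cast totalWeight_weightList_pos a
  have hb : (0 : ℝ) < totalWeight (weightList b) := by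
    exact_mod_cast totalWeight_weightList_pos b
  have key : ∀ C D : List (ℕ × ℕ), ∀ x y : ℕ, 0 < y →
      (totalWeight (weightList a) * totalWeight (weightList b) * y +
        x * totalWeight (weightList a) * totalWeight (weightList b) <
          totalWeight C * totalWeight (weightList b) * y +
            totalWeight D * totalWeight (weightList a) * y ↔
      1 + (x : ℝ) / y < (totalWeight C : ℝ) / totalWeight (weightList a) +
        totalWeight D / totalWeight (weightList b)) := by
    intro C D x y hy
    have hy : (0 : ℝ) < y := by exact_mod_cast hy
    rw [← Nat.cast_lt (α := ℝ), div_add_div _ _ ha.ne' hb.ne', one_add_div hy.ne',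
      div_lt_div_iff₀ hy (by positivity)]
    push_cast
    constructor <;> intro h <;> linarith
  constructor
  · intro h
    have hB : (0 : ℝ) < B := by
      rcases Nat.eq_zero_or_pos B with rfl | hB
      · exact absurd h (by simp)
      · exact_mod_cast hB
    have hA : (A : ℝ) / B < dist (idealMeasure S a) (idealMeasure S b) := (div_lt_iff₀ hB).2 h
    -- The room between `x / y` and `δ'` turns "not in the `δ'`-thickening" into a strict inequality
    -- for distances.
    obtain ⟨δ', h1, h2⟩ := exists_between hA
    obtain ⟨x, y, hy, h3, h4⟩ := exists_nat_div_btwn (by positivity) h1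
    have hy' : (0 : ℝ) < y := by exact_mod_cast hy
    have h5 : ¬ ∀ K, MeasurableSet K → ((idealMeasure S a).toMeasure : Measure X).real K ≤
        ((idealMeasure S b).toMeasure : Measure X).real (Metric.thickening δ' K) + δ' := fun h =>
      h2.not_ge (dist_le_of_forall_measureReal_le
        ((by positivity : (0 : ℝ) ≤ (A : ℝ) / B).trans h1.le) h)
    push Not at h5
    obtain ⟨K, hK, h5⟩ := h5
    refine ⟨(x, y), ⟨hy, ?_⟩, (weightList a).filter fun e => S.ideal e.1 ∈ K,
      List.mem_sublists'.2 List.filter_sublist,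
      (weightList b).filter fun e => S.ideal e.1 ∈ (Metric.thickening δ' K)ᶜ,
      List.mem_sublists'.2 List.filter_sublist, fun e he e' he' => ?_, ?_⟩
    · rw [div_lt_div_iff₀ hB hy'] at h3
      exact_mod_cast h3
    · obtain ⟨-, he⟩ := List.mem_filter.1 he
      obtain ⟨-, he'⟩ := List.mem_filter.1 he'
      have h6 : δ' ≤ dist (S.ideal e'.1) (S.ideal e.1) := by
        by_contra! h7
        rw [dist_comm] at h7
        exact of_decide_eq_true he (Metric.mem_thickening_iff.2 ⟨_, of_decide_eq_true he', h7⟩)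
      exact (div_lt_iff₀ hy').1 (h4.trans_le h6)
    · rw [key _ _ _ _ hy, ← idealMeasure_real, ← idealMeasure_real,
        probReal_compl_eq_one_sub Metric.isOpen_thickening.measurableSet]
      linarith
  · rintro ⟨⟨x, y⟩, ⟨hy, hxy⟩, C, hC, D, hD, h1, h2⟩
    dsimp only at hy hxy h1 h2
    rw [List.mem_sublists'] at hC hD
    have hy' : (0 : ℝ) < y := by exact_mod_cast hy
    have h3 : (x : ℝ) / y ≤ dist (idealMeasure S a) (idealMeasure S b) := by
      by_contra! h3
      set K : Set X := {p | ∃ e ∈ C, S.ideal e.1 = p} with hK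
      have hKm : MeasurableSet K := by
        have : K = (fun e : ℕ × ℕ => S.ideal e.1) '' {e | e ∈ C} := rfl
        rw [this]
        exact ((List.finite_toSet C).image _).measurableSet
      have h4 := measureReal_le_of_dist_lt h3 hKm
      have h5 := le_idealMeasure_real S hC (A := K) fun e he => ⟨e, he, rfl⟩
      have h6 := le_idealMeasure_real S hD (A := (Metric.thickening ((x : ℝ) / y) K)ᶜ) fun e he => by
        intro h7
        obtain ⟨p, ⟨e', he', rfl⟩, h5⟩ := Metric.mem_thickening_iff.1 h7
        rw [dist_comm, lt_div_iff₀ hy'] at h5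
        exact h5.not_ge (h1 e he e' he').le
      rw [probReal_compl_eq_one_sub Metric.isOpen_thickening.measurableSet] at h6
      rw [key _ _ _ _ hy] at h2
      linarith
    refine lt_of_lt_of_le ?_ (mul_le_mul_of_nonneg_right h3 (Nat.cast_nonneg B))
    rw [div_mul_eq_mul_div, lt_div_iff₀ hy']
    exact_mod_cast hxy

theorem semiDec_dist_idealMeasure_mul_lt : SemiDec fun x : (ℕ × ℕ) × ℕ × ℕ =>
    dist (idealMeasure S x.1.1) (idealMeasure S x.1.2) * x.2.2 < x.2.1 := by
  simp only [dist_idealMeasure_mul_lt_iff]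
  refine .exists_ (.and (.and (.of_primrecPred (primrecPred_lt (by fun_prop) (by fun_prop)))
    (.of_primrecPred (primrecPred_lt (by fun_prop) (by fun_prop)))) (.forall_mem (.exists_mem
    (.and (.forall_mem (.exists_mem ?_ (by fun_prop)) (by fun_prop))
      (.of_primrecPred (primrecPred_le (by fun_prop) (by fun_prop)))) (by fun_prop))
    (by fun_prop)))
  exact (semiDec_dist_mul_lt S).comp (f := fun x : (((((((ℕ × ℕ) × ℕ × ℕ) × ℕ × ℕ) ×
    List (ℕ × ℕ)) × List (ℕ × ℕ)) × (ℕ × ℕ)) × ℕ × ℕ) =>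
    ((x.2.1, x.1.2.1), x.1.1.1.1.2)) (by fun_prop)

theorem semiDec_lt_dist_idealMeasure_mul : SemiDec fun x : (ℕ × ℕ) × ℕ × ℕ =>
    x.2.1 < dist (idealMeasure S x.1.1) (idealMeasure S x.1.2) * x.2.2 := by
  simp only [lt_dist_idealMeasure_mul_iff]
  refine .exists_ (.and (.and (.of_primrecPred (primrecPred_lt (by fun_prop) (by fun_prop)))
    (.of_primrecPred (primrecPred_lt (by fun_prop) (by fun_prop)))) (.exists_mem (.exists_mem
    (.and (.forall_mem (.forall_mem ?_ (by fun_prop)) (by fun_prop))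
      (.of_primrecPred (primrecPred_lt (by fun_prop) (by fun_prop)))) (by fun_prop))
    (by fun_prop)))
  exact (semiDec_lt_dist_mul S).comp (f := fun x : (((((((ℕ × ℕ) × ℕ × ℕ) × ℕ × ℕ) ×
    List (ℕ × ℕ)) × List (ℕ × ℕ)) × (ℕ × ℕ)) × ℕ × ℕ) =>
    ((x.2.1, x.1.2.1), x.1.1.1.1.2)) (by fun_prop)

end

/-! ### Stability of integrals under small Prokhorov distance -/

section IntegralComparison

theorem lintegral_natCast_eq_sum {X : Type*} [MeasurableSpace X] (μ : Measure X) {h : X → ℕ}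
    (hm : Measurable h) {Q : ℕ} (hQ : ∀ x, h x ≤ Q) :
    ∫⁻ x, (h x : ℝ≥0∞) ∂μ = ∑ t ∈ Finset.range Q, μ {x | t < h x} := by
  have hs : ∀ t, MeasurableSet {x | t < h x} := fun t => hm measurableSet_Ioi
  have h1 : ∀ x, (h x : ℝ≥0∞) =
      ∑ t ∈ Finset.range Q, Set.indicator {x | t < h x} (fun _ => (1 : ℝ≥0∞)) x := by
    intro x
    simp only [Set.indicator_apply, Set.mem_ofPred_eq, Finset.sum_boole]
    congr 1
    have : (Finset.range Q).filter (fun t => t < h x) = Finset.range (h x) := by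
      ext t
      simp only [Finset.mem_filter, Finset.mem_range]
      have := hQ x
      omega
    rw [this, Finset.card_range]
  simp only [h1]
  rw [lintegral_finsetSum _ fun t _ => measurable_const.indicator (hs t)]
  exact Finset.sum_congr rfl fun t _ => by simp [lintegral_indicator (hs t)]

variable {X : Type*} [MetricSpace X] [MeasurableSpace X] [BorelSpace X]

/-- By the layer-cake formula the integral is a sum of the measures of `Q` superlevel sets. The
`ε`-thickening of a superlevel set of `h` lies in that of `h'`, and each level costs one `ε`. -/
theorem lintegral_natCast_le_of_dist_lt {μ ν : LevyProkhorov (ProbabilityMeasure X)} {ε : ℝ}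
    (hε : dist μ ν < ε) {h h' : X → ℕ} (hm : Measurable h) (hm' : Measurable h') {Q : ℕ}
    (hQ : ∀ x, h x ≤ Q) (hQ' : ∀ x, h' x ≤ Q) (hh : ∀ x y, dist y x < ε → h x ≤ h' y) :
    ∫⁻ x, (h x : ℝ≥0∞) ∂(μ.toMeasure : Measure X) ≤
      ∫⁻ x, (h' x : ℝ≥0∞) ∂(ν.toMeasure : Measure X) + Q * ENNReal.ofReal ε := by
  rw [lintegral_natCast_eq_sum _ hm hQ, lintegral_natCast_eq_sum _ hm' hQ']
  have h1 : ∀ t ∈ Finset.range Q, (μ.toMeasure : Measure X) {x | t < h x} ≤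
      (ν.toMeasure : Measure X) {x | t < h' x} + ENNReal.ofReal ε := by
    intro t _
    refine (measure_le_of_dist_lt hε (hm measurableSet_Ioi)).trans ?_
    gcongr
    intro y hy
    obtain ⟨x, hx, hxy⟩ := Metric.mem_thickening_iff.1 hy
    exact lt_of_lt_of_le hx (hh x y hxy)
  refine (Finset.sum_le_sum h1).trans ?_
  rw [Finset.sum_add_distrib]
  simp

end IntegralComparison

/-! ### Density of the ideal measures -/

theorem exists_weightList_eq {l : List (ℕ × ℕ)} (hl : l ≠ []) : ∃ n, weightList n = l := by
  cases l with
  | nil => exact absurd rfl hl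
  | cons a l =>
    exact ⟨Nat.pair (Nat.pair a.1 a.2) (Encodable.encode l), by simp [weightList]⟩

section Density

variable {X : Type*} [MetricSpace X] [CompleteSpace X] [MeasurableSpace X] [BorelSpace X]
  (S : ComputableMetricSpace X)

theorem exists_measureReal_accumulate_gt (μ : Measure X) [IsProbabilityMeasure μ] {η : ℝ}
    (hη : 0 < η) :
    ∃ N, 1 - η < μ.real (Set.accumulate (fun i => Metric.ball (S.ideal i) η) N) := by
  have h1 : (⋃ i, Metric.ball (S.ideal i) η) = Set.univ := by
    refine Set.eq_univ_of_forall fun x => ?_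
    obtain ⟨i, hi⟩ := S.dense.exists_dist_lt x hη
    exact Set.mem_iUnion.2 ⟨i, hi⟩
  have h2 := tendsto_measure_iUnion_accumulate (μ := μ) (f := fun i => Metric.ball (S.ideal i) η)
  rw [h1, measure_univ] at h2
  have h3 := (ENNReal.tendsto_toReal ENNReal.one_ne_top).comp h2
  exact (h3.eventually_const_lt (by simpa using hη)).exists

/-- Finitely many disjoint pieces of `η`-balls carry all mass but `η`. The mass of each piece is
moved to the centre of its ball and rounded to a rational; the moving, the lost mass and the
rounding fit into distance `2 * η`. -/
theorem exists_dist_idealMeasure_lt (μ : LevyProkhorov (ProbabilityMeasure X)) {ε : ℝ}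
    (hε : 0 < ε) : ∃ n, dist (idealMeasure S n) μ < ε := by
  classical
  set η := ε / 3 with hη
  have hη0 : 0 < η := by positivity
  set m : Measure X := (μ.toMeasure : Measure X) with hm
  set D : ℕ → Set X := disjointed fun i => Metric.ball (S.ideal i) η with hD
  have hDm : ∀ i, MeasurableSet (D i) := fun i =>
    MeasurableSet.disjointed (fun _ => Metric.isOpen_ball.measurableSet) i
  have hDd : Pairwise (Function.onFun Disjoint D) := disjoint_disjointed _
  obtain ⟨N, hN⟩ := exists_measureReal_accumulate_gt S m hη0
  set U := Set.accumulate (fun i => Metric.ball (S.ideal i) η) N with hU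
  have hUD : U = ⋃ i ∈ Finset.range (N + 1), D i := by
    have := biUnion_range_succ_disjointed (fun i => Metric.ball (S.ideal i) η) N
    simp only [Finset.mem_range, hD, hU, Set.accumulate] at this ⊢
    rw [this, partialSups_eq_biSup]
    rfl
  have hUm : MeasurableSet U := by
    rw [hUD]
    exact Finset.measurableSet_biUnion _ fun i _ => hDm i
  -- The weights `w i + 1` exceed `K * m.real (D i)` by at most 1 each. This `K` keeps the total
  -- excess of the `N + 1` pieces below `K * η`.
  obtain ⟨K, hK⟩ := exists_nat_gt ((N + 1) / η)
  have hK0 : (0 : ℝ) < K := lt_trans (by positivity) hK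
  let w : ℕ → ℕ := fun i => ⌊K * m.real (D i)⌋₊
  let g : ℕ → ℕ × ℕ := fun i => (i, w i)
  obtain ⟨n, hn⟩ := exists_weightList_eq (l := (List.range (N + 1)).map g) (by simp)
  have hsum : ∀ l : List ℕ, l.Nodup →
      (totalWeight (l.map g) : ℝ) = ∑ i ∈ l.toFinset, ((w i : ℝ) + 1) := by
    intro l hl
    have : totalWeight (l.map g) = ∑ i ∈ l.toFinset, (w i + 1) := by
      rw [List.sum_toFinset _ hl, totalWeight, List.map_map]
      rfl
    rw [this]
    push_cast
    rfl
  have htot : (totalWeight (weightList n) : ℝ) ≤ K * (1 + η) := by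
    rw [hn, hsum _ List.nodup_range, Finset.sum_add_distrib]
    have h1 : ∑ i ∈ (List.range (N + 1)).toFinset, (w i : ℝ) ≤
        ∑ i ∈ (List.range (N + 1)).toFinset, K * m.real (D i) :=
      Finset.sum_le_sum fun i _ => Nat.floor_le (by positivity)
    have h2 : ∑ i ∈ (List.range (N + 1)).toFinset, m.real (D i) ≤ 1 := by
      rw [← measureReal_biUnion_finset (fun i _ j _ hij => hDd hij) fun i _ => hDm i]
      exact measureReal_le_one
    rw [← Finset.mul_sum] at h1
    have h3 : ((N : ℝ) + 1) < K * η := (div_lt_iff₀ hη0).1 hK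
    simp only [Finset.sum_const, List.toFinset_range, Finset.card_range, nsmul_eq_mul, mul_one,
      Nat.cast_add, Nat.cast_one] at h1 h2 ⊢
    nlinarith
  have hpos : (0 : ℝ) < totalWeight (weightList n) := by
    exact_mod_cast totalWeight_weightList_pos n
  have main : dist μ (idealMeasure S n) ≤ 2 * η := by
    refine dist_le_of_forall_measureReal_le (by positivity) fun A hA => ?_
    set lF : List ℕ := (List.range (N + 1)).filter fun i => (A ∩ D i).Nonempty with hlF
    have hsub : (lF.map g).Sublist (weightList n) := by
      rw [hn]
      exact List.filter_sublist.map g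
    have h1 : (totalWeight (lF.map g) : ℝ) / totalWeight (weightList n) ≤
        ((idealMeasure S n).toMeasure : Measure X).real (Metric.thickening (2 * η) A) := by
      refine le_idealMeasure_real S hsub fun e he => ?_
      obtain ⟨i, hi, rfl⟩ := List.mem_map.1 he
      obtain ⟨x, hxA, hxD⟩ := of_decide_eq_true (List.mem_filter.1 hi).2
      refine Metric.mem_thickening_iff.2 ⟨x, hxA, ?_⟩
      have hx : dist x (S.ideal i) < η := disjointed_subset _ i hxD
      rw [dist_comm]
      linarith
    have h2 : ∑ i ∈ lF.toFinset, m.real (D i) ≤ (totalWeight (lF.map g) : ℝ) / K := by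
      rw [hsum _ (List.nodup_range.filter _), Finset.sum_div]
      refine Finset.sum_le_sum fun i _ => ?_
      rw [le_div_iff₀ hK0, mul_comm]
      exact (Nat.lt_floor_add_one _).le
    have h3 : m.real A ≤ ∑ i ∈ lF.toFinset, m.real (D i) + η := by
      have h4 : A ⊆ (⋃ i ∈ lF.toFinset, D i) ∪ Uᶜ := by
        intro x hx
        by_cases hxU : x ∈ U
        · left
          rw [hUD] at hxU
          simp only [Set.mem_iUnion, exists_prop, Finset.mem_range] at hxU ⊢
          obtain ⟨i, hi, hxi⟩ := hxU
          refine ⟨i, ?_, hxi⟩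
          simp only [hlF, List.mem_toFinset, List.mem_filter, List.mem_range, decide_eq_true_eq]
          exact ⟨hi, x, hx, hxi⟩
        · exact Or.inr hxU
      refine (measureReal_mono h4).trans ((measureReal_union_le _ _).trans ?_)
      rw [probReal_compl_eq_one_sub hUm]
      refine add_le_add (measureReal_biUnion_finset_le _ _) (by linarith)
    have h5 : (totalWeight (lF.map g) : ℝ) / K ≤
        ((idealMeasure S n).toMeasure : Measure X).real (Metric.thickening (2 * η) A) + η := by
      rw [div_le_iff₀ hpos] at h1
      rw [div_le_iff₀ hK0]
      have h6 : ((idealMeasure S n).toMeasure : Measure X).real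
          (Metric.thickening (2 * η) A) ≤ 1 := measureReal_le_one
      have h7 : 0 ≤ ((idealMeasure S n).toMeasure : Measure X).real
          (Metric.thickening (2 * η) A) := measureReal_nonneg
      calc (totalWeight (lF.map g) : ℝ) ≤ _ := h1
        _ ≤ ((idealMeasure S n).toMeasure : Measure X).real
          (Metric.thickening (2 * η) A) * (K * (1 + η)) := by gcongr
        _ ≤ _ := by nlinarith [mul_pos hK0 hη0]
    linarith
  refine ⟨n, ?_⟩
  rw [dist_comm]
  linarith

end Density

/-! ### Names and their prefixes -/

section Names

variable {Y : Type*} [PseudoMetricSpace Y] {s : ℕ → Y}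

/-- Consecutive terms of the list satisfy the condition imposed on names. -/
def IsNamePrefix (s : ℕ → Y) (u : List ℕ) : Prop :=
  ∀ j < u.length - 1, ∃ x y, (u[j]? = some x ∧ u[j + 1]? = some y) ∧
    dist (s x) (s y) < (1 / 2 : ℝ) ^ j

theorem IsCauchyName.isNamePrefix {σ : ℕ → ℕ} {y : Y} (h : IsCauchyName s σ y) (k : ℕ) :
    IsNamePrefix s ((List.range k).map σ) := by
  intro j hj
  simp only [List.length_map, List.length_range] at hj
  refine ⟨σ j, σ (j + 1), ?_, h.1 j⟩
  rw [List.getElem?_map, List.getElem?_map, List.getElem?_range (by omega),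
    List.getElem?_range (by omega)]
  exact ⟨rfl, rfl⟩

/-- The sharper rate ensures that each term of the name is within the radius required of the atom
read off from the prefix ending there. -/
theorem exists_fastName (hs : ∀ y, ∀ ε > 0, ∃ n, dist (s n) y < ε) (y : Y) :
    ∃ σ, IsCauchyName s σ y ∧ ∀ n, dist (s (σ n)) y < (1 / 2 : ℝ) ^ (n + 1) := by
  choose σ hσ using fun n : ℕ => hs y ((1 / 2 : ℝ) ^ (n + 1)) (by positivity)
  refine ⟨σ, ⟨fun n => ?_, ?_⟩, hσ⟩
  · have h1 := hσ n
    have h2 := hσ (n + 1)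
    have h3 := dist_triangle_right (s (σ n)) (s (σ (n + 1))) y
    have h4 : (0 : ℝ) < (1 / 2) ^ n := by positivity
    rw [pow_succ] at h1
    rw [pow_succ, pow_succ] at h2
    linarith
  · refine tendsto_iff_dist_tendsto_zero.2 (squeeze_zero (fun _ => dist_nonneg)
      (fun n => (hσ n).le) ?_)
    exact (tendsto_pow_atTop_nhds_zero_of_lt_one (r := (1 / 2 : ℝ)) (by norm_num)
      (by norm_num)).comp (tendsto_add_atTop_nat 1)

theorem IsNamePrefix.exists_isCauchyName (hs : ∀ y, ∀ ε > 0, ∃ n, dist (s n) y < ε) {u : List ℕ}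
    {b : ℕ} {y : Y} (h : IsNamePrefix s (u ++ [b])) (hb : dist (s b) y < (1 / 2 : ℝ) ^ u.length) :
    ∃ σ, IsCauchyName s σ y ∧ (List.range (u.length + 1)).map σ = u ++ [b] := by
  -- The second bound makes the step from `b` to the first new term legitimate; the first one
  -- handles all later steps.
  choose τ hτ using fun n : ℕ => hs y
    (min ((1 / 2 : ℝ) ^ (n + 1)) ((1 / 2 : ℝ) ^ u.length - dist (s b) y))
    (lt_min (by positivity) (by linarith))
  have hτ1 : ∀ n, dist (s (τ n)) y < (1 / 2 : ℝ) ^ (n + 1) := fun n =>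
    (hτ n).trans_le (min_le_left _ _)
  have hτ2 : ∀ n, dist (s (τ n)) y < (1 / 2 : ℝ) ^ u.length - dist (s b) y := fun n =>
    (hτ n).trans_le (min_le_right _ _)
  let σ : ℕ → ℕ := fun n => (u ++ [b])[n]?.getD (τ n)
  have hσ1 : ∀ n, n ≤ u.length → (u ++ [b])[n]? = some (σ n) := by
    intro n hn
    have : n < (u ++ [b]).length := by simp; omega
    simp only [σ]
    rw [List.getElem?_eq_getElem this]
    rfl
  have hσb : σ u.length = b := by simp [σ]
  have hσ2 : ∀ n, u.length < n → σ n = τ n := by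
    intro n hn
    simp only [σ]
    rw [List.getElem?_eq_none (by simp; omega)]
    rfl
  refine ⟨σ, ⟨fun n => ?_, ?_⟩, ?_⟩
  · rcases lt_trichotomy n u.length with hn | rfl | hn
    · obtain ⟨x, z, ⟨hx, hz⟩, hd⟩ := h n (by simpa using hn)
      rw [hσ1 n hn.le, Option.some_inj] at hx
      rw [hσ1 (n + 1) hn, Option.some_inj] at hz
      rwa [hx, hz]
    · rw [hσb, hσ2 _ (Nat.lt_succ_self _)]
      have h1 := hτ2 (u.length + 1)
      have h3 := dist_triangle_right (s b) (s (τ (u.length + 1))) y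
      linarith
    · rw [hσ2 _ hn, hσ2 _ (by omega)]
      have h1 := hτ1 n
      have h2 := hτ1 (n + 1)
      have h3 := dist_triangle_right (s (τ n)) (s (τ (n + 1))) y
      have h4 : (0 : ℝ) < (1 / 2) ^ n := by positivity
      rw [pow_succ] at h1
      rw [pow_succ, pow_succ] at h2
      linarith
  · refine tendsto_iff_dist_tendsto_zero.2 (squeeze_zero' (Eventually.of_forall
      fun _ => dist_nonneg) ((eventually_gt_atTop u.length).mono fun n hn => ?_)
      ((tendsto_pow_atTop_nhds_zero_of_lt_one (r := (1 / 2 : ℝ)) (by norm_num)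
        (by norm_num)).comp (tendsto_add_atTop_nat 1)))
    rw [hσ2 n hn]
    exact (hτ1 n).le
  · refine List.ext_getElem? fun n => ?_
    by_cases hn : n ≤ u.length
    · rw [hσ1 n hn]
      simp [Nat.lt_succ_of_le hn]
    · rw [List.getElem?_eq_none (by simp; omega), List.getElem?_eq_none (by simp; omega)]

end Names

/-! ### Coordinates of step functions and atoms -/

/-- The index of the centre of the ball of the step function with code `m`. -/
def stepCenter (m : ℕ) : ℕ := m.unpair.1.unpair.1

/-- The radius of the ball of the step function with code `m`. -/
noncomputable def stepRadius (m : ℕ) : ℝ := posRatNum m.unpair.1.unpair.2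

/-- The numerator of the radius of the ball of the step function with code `m`. -/
def stepRadiusNum (m : ℕ) : ℕ := m.unpair.1.unpair.2.unpair.1 + 1

/-- The denominator of the radius of the ball of the step function with code `m`. -/
def stepRadiusDen (m : ℕ) : ℕ := m.unpair.1.unpair.2.unpair.2 + 1

/-- The numerator of the value of the step function with code `m`. -/
def stepValue (m : ℕ) : ℕ := m.unpair.2.unpair.1

/-- The index of the ideal measure which is the centre of the ball of measures of an atom. -/
def atomMeasure (i : ℕ) : ℕ := i.unpair.1.unpair.1

/-- The atom `i` concerns the measures at distance less than `2 ^ (-atomExponent i)` from its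
ideal measure. -/
def atomExponent (i : ℕ) : ℕ := i.unpair.1.unpair.2

/-- The code of the step function of an atom. -/
def atomStep (i : ℕ) : ℕ := i.unpair.2.unpair.1

section Primrec

variable {α : Type*} [Primcodable α] {f : α → ℕ}

@[fun_prop]
theorem primrec_stepCenter (hf : Primrec f) : Primrec fun a => stepCenter (f a) := by
  unfold stepCenter; fun_prop

@[fun_prop]
theorem primrec_stepRadiusNum (hf : Primrec f) : Primrec fun a => stepRadiusNum (f a) := by
  unfold stepRadiusNum; fun_prop

@[fun_prop]
theorem primrec_stepRadiusDen (hf : Primrec f) : Primrec fun a => stepRadiusDen (f a) := by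
  unfold stepRadiusDen; fun_prop

@[fun_prop]
theorem primrec_stepValue (hf : Primrec f) : Primrec fun a => stepValue (f a) := by
  unfold stepValue; fun_prop

@[fun_prop]
theorem primrec_atomMeasure (hf : Primrec f) : Primrec fun a => atomMeasure (f a) := by
  unfold atomMeasure; fun_prop

@[fun_prop]
theorem primrec_atomExponent (hf : Primrec f) : Primrec fun a => atomExponent (f a) := by
  unfold atomExponent; fun_prop

@[fun_prop]
theorem primrec_atomStep (hf : Primrec f) : Primrec fun a => atomStep (f a) := by
  unfold atomStep; fun_prop

end Primrec

theorem stepRadiusDen_pos (m : ℕ) : 0 < stepRadiusDen m := Nat.succ_pos _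

theorem stepRadius_eq (m : ℕ) : stepRadius m = (stepRadiusNum m : ℝ) / stepRadiusDen m := by
  simp [stepRadius, posRatNum, stepRadiusNum, stepRadiusDen]

/-- Pairing dominates its components, so the atoms up to `i` have values at most `i`. This supplies
the uniform bound needed to compare their integrals. -/
theorem stepValue_atomStep_le (i : ℕ) : stepValue (atomStep i) ≤ i :=
  (Nat.unpair_left_le _).trans ((Nat.unpair_right_le _).trans
    ((Nat.unpair_left_le _).trans (Nat.unpair_right_le _)))

/-! ### Maxima of finitely many atoms on enlarged closed balls -/

section Cap

variable {X : Type*} [MetricSpace X] [CompleteSpace X] (S : ComputableMetricSpace X)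

/-- The maximum of the values of the atoms in `A` over those whose closed ball, enlarged by `δ`,
contains `x`. -/
noncomputable def cap (A : Finset ℕ) (δ : ℝ) (x : X) : ℕ :=
  A.sup fun i => if dist x (S.ideal (stepCenter (atomStep i))) ≤ stepRadius (atomStep i) + δ
    then stepValue (atomStep i) else 0

variable {S}

theorem cap_le_iff {A : Finset ℕ} {δ : ℝ} {x : X} {v : ℕ} :
    cap S A δ x ≤ v ↔ ∀ i ∈ A, dist x (S.ideal (stepCenter (atomStep i))) ≤
      stepRadius (atomStep i) + δ → stepValue (atomStep i) ≤ v := by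
  rw [cap, Finset.sup_le_iff]
  refine forall₂_congr fun i _ => ?_
  split_ifs with h <;> simp [h]

theorem le_cap {A : Finset ℕ} {δ : ℝ} {x : X} {i : ℕ} (hi : i ∈ A)
    (h : dist x (S.ideal (stepCenter (atomStep i))) ≤ stepRadius (atomStep i) + δ) :
    stepValue (atomStep i) ≤ cap S A δ x :=
  cap_le_iff.1 le_rfl i hi h

theorem cap_le_cap {A A' : Finset ℕ} (hA : A ⊆ A') {δ δ' : ℝ} {x y : X}
    (h : δ + dist x y ≤ δ') : cap S A δ x ≤ cap S A' δ' y := by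
  refine cap_le_iff.2 fun i hi hx => le_cap (hA hi) ?_
  have := dist_triangle_left y (S.ideal (stepCenter (atomStep i))) x
  linarith

theorem cap_le_of_subset_range {A : Finset ℕ} {n : ℕ} (hA : A ⊆ Finset.range (n + 1)) (δ : ℝ)
    (x : X) : cap S A δ x ≤ n := by
  refine cap_le_iff.2 fun i hi _ => (stepValue_atomStep_le i).trans ?_
  exact Nat.lt_succ_iff.1 (Finset.mem_range.1 (hA hi))

theorem measurable_cap [MeasurableSpace X] [BorelSpace X] (A : Finset ℕ) (δ : ℝ) :
    Measurable (cap S A δ) := by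
  unfold cap
  induction A using Finset.induction_on with
  | empty => simp
  | insert i A _ ih =>
    simp only [Finset.sup_insert]
    refine Measurable.sup (Measurable.ite ?_ measurable_const measurable_const) ih
    exact (isClosed_le (continuous_id.dist continuous_const) continuous_const).measurableSet

/-- A point outside a closed ball stays outside all sufficiently small enlargements, and there are
finitely many balls. -/
theorem eventually_cap_eq (A : Finset ℕ) (x : X) {δ : ℕ → ℝ} (h0 : ∀ k, 0 ≤ δ k)
    (hδ : Tendsto δ atTop (𝓝 0)) : ∀ᶠ k in atTop, cap S A (δ k) x = cap S A 0 x := by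
  have h : ∀ i ∈ A, ∀ᶠ k in atTop,
      (dist x (S.ideal (stepCenter (atomStep i))) ≤ stepRadius (atomStep i) + δ k ↔
        dist x (S.ideal (stepCenter (atomStep i))) ≤ stepRadius (atomStep i) + 0) := by
    intro i _
    by_cases hx : dist x (S.ideal (stepCenter (atomStep i))) ≤ stepRadius (atomStep i) + 0
    · exact Eventually.of_forall fun k => iff_of_true (hx.trans (by have := h0 k; gcongr)) hx
    · have h1 := tendsto_const_nhds (x := stepRadius (atomStep i)) |>.add hδ
      filter_upwards [h1.eventually_lt_const (not_le.1 hx)] with k hk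
      exact iff_of_false (not_le.2 hk) hx
  filter_upwards [(eventually_all_finset A).2 h] with k hk
  refine Finset.sup_congr rfl fun i hi => ?_
  simp only [hk i hi]

theorem tendsto_lintegral_cap [MeasurableSpace X] [BorelSpace X] (μ : Measure X)
    [IsProbabilityMeasure μ] {n : ℕ} {A : Finset ℕ} (hA : A ⊆ Finset.range (n + 1)) {δ : ℕ → ℝ}
    (h0 : ∀ k, 0 ≤ δ k) (hδ : Tendsto δ atTop (𝓝 0)) :
    Tendsto (fun k => ∫⁻ x, (cap S A (δ k) x : ℝ≥0∞) ∂μ) atTop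
      (𝓝 (∫⁻ x, (cap S A 0 x : ℝ≥0∞) ∂μ)) := by
  refine tendsto_lintegral_of_dominated_convergence (fun _ => (n : ℝ≥0∞))
    (fun k => measurable_from_top.comp (measurable_cap A (δ k))) (fun k => ?_) (by simp) ?_
  · exact Eventually.of_forall fun x => Nat.cast_le.2 (cap_le_of_subset_range hA _ x)
  · refine Eventually.of_forall fun x => tendsto_const_nhds.congr' ?_
    filter_upwards [eventually_cap_eq A x h0 hδ] with k hk
    rw [hk]

end Cap

/-! ### Trimming and its finite certificates -/

/-- The sum of the bounds in a list of triples (index, weight, bound), each with its weight. -/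
def boundSum (L : List ((ℕ × ℕ) × ℕ)) : ℕ := (L.map fun e => (e.1.2 + 1) * e.2).sum

@[fun_prop]
theorem primrec_boundSum {α : Type*} [Primcodable α] {f : α → List ((ℕ × ℕ) × ℕ)}
    (hf : Primrec f) : Primrec fun a => boundSum (f a) := by
  refine (Primrec.list_foldr (h := fun (_ : α) (x : ((ℕ × ℕ) × ℕ) × ℕ) =>
    (x.1.1.2 + 1) * x.1.2 + x.2) hf (Primrec.const 0) ?_).of_eq fun a => ?_
  · show Primrec fun y : α × ((ℕ × ℕ) × ℕ) × ℕ => (y.2.1.1.2 + 1) * y.2.1.2 + y.2.2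
    fun_prop
  · unfold boundSum
    induction f a with
    | nil => rfl
    | cons b l ih => simp only [List.foldr_cons, ih, List.map_cons, List.sum_cons]

theorem inv_mul_add_lt_two_iff {B i k t : ℕ} (ht : 0 < t) :
    (t : ℝ≥0∞)⁻¹ * B + i * ENNReal.ofReal ((1 / 2) ^ k) < 2 ↔
      2 ^ k * B + i * t < 2 * 2 ^ k * t := by
  have ht' : (0 : ℝ) < t := by exact_mod_cast ht
  have e : (t : ℝ≥0∞)⁻¹ * B + i * ENNReal.ofReal ((1 / 2) ^ k) =
      ENNReal.ofReal ((t : ℝ)⁻¹ * B + i * (1 / 2) ^ k) := by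
    rw [ENNReal.ofReal_add (by positivity) (by positivity), ENNReal.ofReal_mul (by positivity),
      ENNReal.ofReal_mul (by positivity), ENNReal.ofReal_inv_of_pos ht']
    simp only [ENNReal.ofReal_natCast]
  have e2 : (2 : ℝ≥0∞) = ENNReal.ofReal 2 := by simp
  rw [e, e2, ENNReal.ofReal_lt_ofReal_iff (by norm_num), ← Nat.cast_lt (α := ℝ)]
  have h2 : (0 : ℝ) < 2 ^ k * t := by positivity
  rw [← mul_lt_mul_iff_left₀ h2]
  push_cast
  have e3 : ((t : ℝ)⁻¹ * B + i * (1 / 2) ^ k) * (2 ^ k * t) = 2 ^ k * B + i * t := by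
    rw [one_div, inv_pow]
    field_simp
  rw [e3]
  constructor <;> intro h <;> linarith

section Trimming

variable {X : Type*} [MetricSpace X] [CompleteSpace X] [MeasurableSpace X] [BorelSpace X]
  (S : ComputableMetricSpace X)

theorem lintegral_natCast_idealMeasure (a : ℕ) (h : X → ℕ) :
    ∫⁻ x, (h x : ℝ≥0∞) ∂((idealMeasure S a).toMeasure : Measure X) =
      (totalWeight (weightList a) : ℝ≥0∞)⁻¹ *
        boundSum ((weightList a).map fun e => (e, h (S.ideal e.1))) := by
  rw [coe_idealMeasure, lintegral_smul_measure, lintegral_weightedSum, smul_eq_mul, boundSum,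
    List.map_map, Nat.cast_list_sum, List.map_map]
  congr 3
  ext e
  simp

open Classical in
/-- The atoms up to `i` which satisfy `P` and whose closed ball of measures contains `μ`. -/
noncomputable def activeAtoms (P : ℕ → Prop) (μ : LevyProkhorov (ProbabilityMeasure X)) (i : ℕ) :
    Finset ℕ :=
  (Finset.range (i + 1)).filter fun j => P j ∧
    dist (idealMeasure S (atomMeasure j)) μ ≤ (1 / 2 : ℝ) ^ atomExponent j

/-- The atoms that satisfy `P` and apply to `μ`, so long as the integral of the atoms enumerated
so far stays below `2`. -/
def trimmed (P : ℕ → Prop) (μ : LevyProkhorov (ProbabilityMeasure X)) : Set ℕ :=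
  {i | P i ∧ dist (idealMeasure S (atomMeasure i)) μ < (1 / 2 : ℝ) ^ atomExponent i ∧
    ∫⁻ x, (cap S (activeAtoms S P μ i) 0 x : ℝ≥0∞) ∂(μ.toMeasure : Measure X) < 2}

/-- A finite certificate that the atom `i` belongs to `trimmed S P μ` for all `μ` at distance less
than `2 ^ (-k)` from the ideal measure `a`. -/
def TrimCertificate (P : ℕ → Prop) (i a k : ℕ) : Prop :=
  dist (idealMeasure S a) (idealMeasure S (atomMeasure i)) + (1 / 2 : ℝ) ^ k <
      (1 / 2 : ℝ) ^ atomExponent i ∧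
    ∃ L : List ((ℕ × ℕ) × ℕ), L.map Prod.fst = weightList a ∧
      (∀ e ∈ L, ∀ j < i + 1, ¬ P j ∨
        (1 / 2 : ℝ) ^ atomExponent j + (1 / 2 : ℝ) ^ k <
          dist (idealMeasure S a) (idealMeasure S (atomMeasure j)) ∨
        stepValue (atomStep j) ≤ e.2 ∨
        stepRadius (atomStep j) + (1 / 2 : ℝ) ^ k <
          dist (S.ideal e.1.1) (S.ideal (stepCenter (atomStep j)))) ∧
      2 ^ k * boundSum L + i * totalWeight (weightList a) <
        2 * 2 ^ k * totalWeight (weightList a)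

variable {S}

theorem activeAtoms_subset_range (P : ℕ → Prop) (μ : LevyProkhorov (ProbabilityMeasure X))
    (i : ℕ) : activeAtoms S P μ i ⊆ Finset.range (i + 1) := by
  classical exact Finset.filter_subset _ _

theorem mem_activeAtoms {P : ℕ → Prop} {μ : LevyProkhorov (ProbabilityMeasure X)} {i j : ℕ} :
    j ∈ activeAtoms S P μ i ↔ j < i + 1 ∧ P j ∧
      dist (idealMeasure S (atomMeasure j)) μ ≤ (1 / 2 : ℝ) ^ atomExponent j := by
  classical
  simp [activeAtoms]

/-- Passing from `μ` to the ideal measure `a` costs `i * 2 ^ (-k)` and an enlargement of the balls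
by `2 ^ (-k)`. The list `L` bounds the enlarged maximum at each point of `a`, and every atom it
ignores is certified inactive at `μ` or irrelevant at that point. -/
theorem TrimCertificate.mem_trimmed {P : ℕ → Prop} {i a k : ℕ} (h : TrimCertificate S P i a k)
    (hi : P i) {μ : LevyProkhorov (ProbabilityMeasure X)}
    (hμ : dist (idealMeasure S a) μ < (1 / 2 : ℝ) ^ k) : i ∈ trimmed S P μ := by
  obtain ⟨h1, L, hL, h2, h3⟩ := h
  refine ⟨hi, ?_, ?_⟩
  · have := dist_triangle_left (idealMeasure S (atomMeasure i)) μ (idealMeasure S a)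
    linarith
  have hA := activeAtoms_subset_range (S := S) P μ i
  have h4 := lintegral_natCast_le_of_dist_lt (dist_comm (idealMeasure S a) μ ▸ hμ)
    (measurable_cap (S := S) (activeAtoms S P μ i) 0)
    (measurable_cap (S := S) (activeAtoms S P μ i) ((1 / 2) ^ k))
    (cap_le_of_subset_range hA _) (cap_le_of_subset_range hA _)
    (fun x y hxy => cap_le_cap subset_rfl (by rw [dist_comm x y]; linarith))
  refine h4.trans_lt (lt_of_le_of_lt ?_
    ((inv_mul_add_lt_two_iff (totalWeight_weightList_pos a)).2 h3))
  rw [lintegral_natCast_idealMeasure]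
  gcongr
  rw [← hL, List.map_map, boundSum, boundSum, List.map_map]
  refine List.sum_le_sum fun e he => ?_
  refine Nat.mul_le_mul_left _ ?_
  show cap S (activeAtoms S P μ i) ((1 / 2) ^ k) (S.ideal e.1.1) ≤ e.2
  refine cap_le_iff.2 fun j hj hd => ?_
  obtain ⟨hj1, hj2, hj3⟩ := mem_activeAtoms.1 hj
  rcases h2 e he j hj1 with h5 | h5 | h5 | h5
  · exact absurd hj2 h5
  · have := dist_triangle_right (idealMeasure S a) (idealMeasure S (atomMeasure j)) μ
    linarith
  · exact h5
  · exact absurd hd (not_le.2 h5)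

/-- All the conditions at `μ` are strict, so they survive at a close enough ideal measure. The
factors 2 below absorb both the distance from `τ k` to `μ` and the margin in the certificate. -/
theorem exists_trimCertificate {P : ℕ → Prop} {i : ℕ} {μ : LevyProkhorov (ProbabilityMeasure X)}
    (hi : i ∈ trimmed S P μ) {τ : ℕ → ℕ}
    (hτ : ∀ k, dist (idealMeasure S (τ k)) μ < (1 / 2 : ℝ) ^ k) :
    ∃ k, TrimCertificate S P i (τ k) k := by
  classical
  obtain ⟨-, hi1, hi2⟩ := hi
  have hA := activeAtoms_subset_range (S := S) P μ i
  have hlim := tendsto_two_mul_half_pow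
  have ev1 : ∀ᶠ k : ℕ in atTop, 2 * (1 / 2 : ℝ) ^ k <
      (1 / 2 : ℝ) ^ atomExponent i - dist (idealMeasure S (atomMeasure i)) μ :=
    hlim.eventually_lt_const (by linarith)
  have ev2 : ∀ᶠ k : ℕ in atTop, ∀ j ∈ Finset.range (i + 1), P j → j ∉ activeAtoms S P μ i →
      2 * (1 / 2 : ℝ) ^ k <
        dist (idealMeasure S (atomMeasure j)) μ - (1 / 2 : ℝ) ^ atomExponent j := by
    refine (eventually_all_finset _).2 fun j hj => ?_
    by_cases h : P j ∧ j ∉ activeAtoms S P μ i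
    · have h1 : (1 / 2 : ℝ) ^ atomExponent j < dist (idealMeasure S (atomMeasure j)) μ := by
        by_contra! h2
        exact h.2 (mem_activeAtoms.2 ⟨Finset.mem_range.1 hj, h.1, h2⟩)
      exact (hlim.eventually_lt_const (sub_pos.2 h1)).mono fun k hk _ _ => hk
    · exact Eventually.of_forall fun k h1 h2 => absurd ⟨h1, h2⟩ h
  have ev3 : ∀ᶠ k : ℕ in atTop,
      ∫⁻ x, (cap S (activeAtoms S P μ i) (2 * (1 / 2 : ℝ) ^ k) x : ℝ≥0∞) ∂(μ.toMeasure : Measure X) +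
        i * ENNReal.ofReal (2 * (1 / 2 : ℝ) ^ k) < 2 := by
    have h1 := tendsto_lintegral_cap (S := S) (μ.toMeasure : Measure X) hA
      (fun k => by positivity) hlim
    have h2 : Tendsto (fun k : ℕ => (i : ℝ≥0∞) * ENNReal.ofReal (2 * (1 / 2 : ℝ) ^ k)) atTop
        (𝓝 ((i : ℝ≥0∞) * ENNReal.ofReal 0)) :=
      ENNReal.Tendsto.const_mul (ENNReal.tendsto_ofReal hlim) (Or.inr (by simp))
    have h3 := h1.add h2
    simp only [ENNReal.ofReal_zero, mul_zero, add_zero] at h3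
    exact h3.eventually_lt_const hi2
  obtain ⟨k, hk1, hk2, hk3⟩ := (ev1.and (ev2.and ev3)).exists
  set a := τ k with ha
  have hk := hτ k
  rw [← ha] at hk
  -- `B` consists of the atoms that cannot be certified inactive at precision `k`; by the choice of
  -- `k` they are all active at `μ`.
  set B : Finset ℕ := (Finset.range (i + 1)).filter fun j => P j ∧
    ¬ (1 / 2 : ℝ) ^ atomExponent j + (1 / 2 : ℝ) ^ k <
      dist (idealMeasure S a) (idealMeasure S (atomMeasure j)) with hB
  have hBr : B ⊆ Finset.range (i + 1) := Finset.filter_subset _ _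
  have hBA : B ⊆ activeAtoms S P μ i := by
    intro j hj
    obtain ⟨hj1, hj2, hj3⟩ := Finset.mem_filter.1 hj
    by_contra h
    have h1 := hk2 j hj1 hj2 h
    have := dist_triangle_left (idealMeasure S (atomMeasure j)) μ (idealMeasure S a)
    exact hj3 (by linarith)
  refine ⟨k, ?_, (weightList a).map fun e => (e, cap S B ((1 / 2) ^ k) (S.ideal e.1)), ?_, ?_, ?_⟩
  · have := dist_triangle_right (idealMeasure S a) (idealMeasure S (atomMeasure i)) μ
    linarith
  · rw [List.map_map]
    exact List.map_id _
  · intro e he j hj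
    obtain ⟨e', -, rfl⟩ := List.mem_map.1 he
    by_cases h1 : P j
    · by_cases h2 : (1 / 2 : ℝ) ^ atomExponent j + (1 / 2 : ℝ) ^ k <
        dist (idealMeasure S a) (idealMeasure S (atomMeasure j))
      · exact Or.inr (Or.inl h2)
      · by_cases h3 : stepRadius (atomStep j) + (1 / 2 : ℝ) ^ k <
          dist (S.ideal e'.1) (S.ideal (stepCenter (atomStep j)))
        · exact Or.inr (Or.inr (Or.inr h3))
        · exact Or.inr (Or.inr (Or.inl (le_cap
            (Finset.mem_filter.2 ⟨Finset.mem_range.2 hj, h1, h2⟩) (not_lt.1 h3))))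
    · exact Or.inl h1
  · rw [← inv_mul_add_lt_two_iff (totalWeight_weightList_pos a), ← lintegral_natCast_idealMeasure]
    have h4 := lintegral_natCast_le_of_dist_lt hk
      (measurable_cap (S := S) B ((1 / 2) ^ k))
      (measurable_cap (S := S) (activeAtoms S P μ i) (2 * (1 / 2) ^ k))
      (cap_le_of_subset_range hBr _) (cap_le_of_subset_range hA _)
      (fun x y hxy => cap_le_cap hBA (by rw [dist_comm x y]; linarith))
    refine lt_of_le_of_lt (add_le_add_left h4 _) ?_
    rw [add_assoc, ← mul_add, ← ENNReal.ofReal_add (by positivity) (by positivity), ← two_mul]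
    exact hk3

theorem add_half_pow_lt_half_pow_iff {d : ℝ} (hd : 0 ≤ d) (k l : ℕ) :
    d + (1 / 2 : ℝ) ^ k < (1 / 2 : ℝ) ^ l ↔ d * (2 ^ (k + l) : ℕ) < (2 ^ k - 2 ^ l : ℕ) := by
  have h : (0 : ℝ) < 2 ^ (k + l) := by positivity
  rw [← mul_lt_mul_iff_left₀ h]
  have e1 : (1 / 2 : ℝ) ^ l * 2 ^ (k + l) = 2 ^ k := by
    rw [one_div, inv_pow, pow_add]; field_simp
  have e2 : (1 / 2 : ℝ) ^ k * 2 ^ (k + l) = 2 ^ l := by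
    rw [one_div, inv_pow, pow_add]; field_simp
  rw [add_mul, e1, e2]
  rcases le_total (2 ^ l) (2 ^ k) with h1 | h1
  · push_cast [Nat.cast_sub h1]
    constructor <;> intro h <;> linarith
  -- Truncated subtraction gives 0 here, and both inequalities are false.
  · rw [Nat.sub_eq_zero_of_le h1]
    have h2 : (2 : ℝ) ^ k ≤ 2 ^ l := by exact_mod_cast h1
    have h3 : 0 ≤ d * 2 ^ (k + l) := by positivity
    push_cast
    constructor <;> intro h <;> linarith

theorem half_pow_add_half_pow_lt_iff (d : ℝ) (k l : ℕ) :
    (1 / 2 : ℝ) ^ l + (1 / 2 : ℝ) ^ k < d ↔ (2 ^ k + 2 ^ l : ℕ) < d * (2 ^ (k + l) : ℕ) := by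
  have h : (0 : ℝ) < 2 ^ (k + l) := by positivity
  rw [← mul_lt_mul_iff_left₀ h]
  have e1 : (1 / 2 : ℝ) ^ l * 2 ^ (k + l) = 2 ^ k := by
    rw [one_div, inv_pow, pow_add]; field_simp
  have e2 : (1 / 2 : ℝ) ^ k * 2 ^ (k + l) = 2 ^ l := by
    rw [one_div, inv_pow, pow_add]; field_simp
  rw [add_mul, e1, e2]
  push_cast
  rfl

theorem stepRadius_add_half_pow_lt_iff (d : ℝ) (m k : ℕ) :
    stepRadius m + (1 / 2 : ℝ) ^ k < d ↔
      (stepRadiusNum m * 2 ^ k + stepRadiusDen m : ℕ) < d * (stepRadiusDen m * 2 ^ k : ℕ) := by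
  have h0 : (0 : ℝ) < stepRadiusDen m := by exact_mod_cast stepRadiusDen_pos m
  have h : (0 : ℝ) < stepRadiusDen m * 2 ^ k := by positivity
  rw [← mul_lt_mul_iff_left₀ h, stepRadius_eq]
  push_cast
  have e : ((stepRadiusNum m : ℝ) / stepRadiusDen m + (1 / 2) ^ k) * (stepRadiusDen m * 2 ^ k) =
      stepRadiusNum m * 2 ^ k + stepRadiusDen m := by
    rw [one_div, inv_pow]
    field_simp
  rw [e]

set_option maxHeartbeats 1000000 in
variable (S) in
theorem semiDec_trimCertificate {P : ℕ → ℕ → Prop} (hP : PrimrecPred fun x : ℕ × ℕ => P x.1 x.2) :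
    SemiDec fun x : (ℕ × ℕ) × ℕ × ℕ => TrimCertificate S (P x.1.1) x.1.2 x.2.1 x.2.2 := by
  unfold TrimCertificate
  simp only [add_half_pow_lt_half_pow_iff dist_nonneg, half_pow_add_half_pow_lt_iff,
    stepRadius_add_half_pow_lt_iff]
  refine .and ?_ (.exists_ (.and (.of_primrecPred (primrecPred_eq ?_ (by fun_prop)))
    (.and (.forall_mem (.forall_lt (.or ?_ (.or ?_ (.or ?_ ?_))) (by fun_prop)) (by fun_prop))
      (.of_primrecPred (primrecPred_lt (by fun_prop) (by fun_prop))))))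
  · exact (semiDec_dist_idealMeasure_mul_lt S).comp (f := fun x : (ℕ × ℕ) × ℕ × ℕ =>
      ((x.2.1, atomMeasure x.1.2),
        (2 ^ x.2.2 - 2 ^ atomExponent x.1.2, 2 ^ (x.2.2 + atomExponent x.1.2)))) (by fun_prop)
  · exact Primrec.list_map Primrec.snd (Primrec.fst.comp Primrec.snd)
  -- Here `P` occurs negated, which is why it has to be decidable and not merely semidecidable.
  · exact .of_primrecPred (hP.not.comp (f := fun x : ((((ℕ × ℕ) × ℕ × ℕ) × List ((ℕ × ℕ) × ℕ)) ×
      ((ℕ × ℕ) × ℕ)) × ℕ => (x.1.1.1.1.1, x.2)) (by fun_prop))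
  · exact (semiDec_lt_dist_idealMeasure_mul S).comp (f := fun x : ((((ℕ × ℕ) × ℕ × ℕ) ×
      List ((ℕ × ℕ) × ℕ)) × ((ℕ × ℕ) × ℕ)) × ℕ => ((x.1.1.1.2.1, atomMeasure x.2),
        (2 ^ x.1.1.1.2.2 + 2 ^ atomExponent x.2, 2 ^ (x.1.1.1.2.2 + atomExponent x.2))))
      (by fun_prop)
  · exact .of_primrecPred (primrecPred_le (by fun_prop) (by fun_prop))
  · exact (semiDec_lt_dist_mul S).comp (f := fun x : ((((ℕ × ℕ) × ℕ × ℕ) ×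
      List ((ℕ × ℕ) × ℕ)) × ((ℕ × ℕ) × ℕ)) × ℕ => ((x.1.2.1.1, stepCenter (atomStep x.2)),
        (stepRadiusNum (atomStep x.2) * 2 ^ x.1.1.1.2.2 + stepRadiusDen (atomStep x.2),
          stepRadiusDen (atomStep x.2) * 2 ^ x.1.1.1.2.2)))
      (by fun_prop)

end Trimming

/-! ### Refinement and scaling of step functions -/

/-- The step function `m` has a natural number as value, and formally its closed ball and its value
are smaller than those of the step function `n`. -/
def StepRefines (m n : ℕ) : Prop :=
  (stepCenter m = stepCenter n ∧
    stepRadiusNum m * stepRadiusDen n < stepRadiusNum n * stepRadiusDen m) ∧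
  m.unpair.2.unpair.2 = 0 ∧ stepValue m * (n.unpair.2.unpair.2 + 1) ≤ stepValue n

/-- The code of the step function `m` with its value divided by `2 ^ (c + 3)`. -/
def scaleStep (c m : ℕ) : ℕ := Nat.pair m.unpair.1 (Nat.pair (stepValue m) (2 ^ (c + 3) - 1))

theorem StepRefines.stepRadius_lt {m n : ℕ} (h : StepRefines m n) :
    stepRadius m < stepRadius n := by
  rw [stepRadius_eq, stepRadius_eq, div_lt_div_iff₀ (by exact_mod_cast stepRadiusDen_pos m)
    (by exact_mod_cast stepRadiusDen_pos n)]
  exact_mod_cast h.1.2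

theorem nnRatNum_unpair_snd (n : ℕ) :
    (nnRatNum n.unpair.2 : ℝ≥0∞) = (stepValue n : ℝ≥0∞) / ((n.unpair.2.unpair.2 + 1 : ℕ) : ℝ≥0∞) := by
  rw [nnRatNum, stepValue, ENNReal.coe_div (by positivity)]
  push_cast
  rfl

theorem StepRefines.stepValue_le {m n : ℕ} (h : StepRefines m n) :
    (stepValue m : ℝ≥0∞) ≤ nnRatNum n.unpair.2 := by
  rw [nnRatNum_unpair_snd, ENNReal.le_div_iff_mul_le (by simp) (by simp)]
  exact_mod_cast h.2.2

/-- The radius is a rational between `r` and the radius of `n`; the value is the integer part of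
that of `n`, hence the loss of at most 1. -/
theorem exists_stepRefines {n : ℕ} {r : ℝ} (h0 : 0 ≤ r) (hr : r < stepRadius n) :
    ∃ m, StepRefines m n ∧ r < stepRadius m ∧ (nnRatNum n.unpair.2 : ℝ≥0∞) ≤ stepValue m + 1 := by
  obtain ⟨x, y, hy, h1, h2⟩ := exists_nat_div_btwn h0 hr
  have hy' : (0 : ℝ) < y := by exact_mod_cast hy
  have hx : 0 < x := by
    have : (0 : ℝ) < x := by
      have := h0.trans_lt h1
      rwa [lt_div_iff₀ hy', zero_mul] at this
    exact_mod_cast this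
  set m := Nat.pair (Nat.pair (stepCenter n) (Nat.pair (x - 1) (y - 1)))
    (Nat.pair (stepValue n / (n.unpair.2.unpair.2 + 1)) 0) with hm
  have hnum : stepRadiusNum m = x := by simp [stepRadiusNum, hm, Nat.sub_add_cancel hx]
  have hden : stepRadiusDen m = y := by simp [stepRadiusDen, hm, Nat.sub_add_cancel hy]
  have hval : stepValue m = stepValue n / (n.unpair.2.unpair.2 + 1) := by simp [stepValue, hm]
  refine ⟨m, ⟨⟨by simp [stepCenter, hm], ?_⟩, by simp [hm], ?_⟩, ?_, ?_⟩
  · rw [hnum, hden]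
    rw [stepRadius_eq, div_lt_div_iff₀ hy' (by exact_mod_cast stepRadiusDen_pos n)] at h2
    exact_mod_cast h2
  · rw [hval]
    exact Nat.div_mul_le_self _ _
  · rwa [stepRadius_eq, hnum, hden]
  · rw [nnRatNum_unpair_snd, ENNReal.div_le_iff (by simp) (by simp), hval]
    have := Nat.lt_succ_iff.1 (Nat.lt_succ_of_lt
      (Nat.lt_mul_div_succ (stepValue n) (Nat.succ_pos n.unpair.2.unpair.2)))
    rw [mul_comm] at this
    exact_mod_cast this

section Steps

variable {X : Type*} [MetricSpace X] [CompleteSpace X] (S : ComputableMetricSpace X)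

theorem stepFun_apply (n : ℕ) (x : X) : stepFun S ennrealLattice n x =
    if dist x (S.ideal (stepCenter n)) < stepRadius n then (nnRatNum n.unpair.2 : ℝ≥0∞) else 0 := by
  classical
  unfold stepFun
  exact if_congr Iff.rfl rfl rfl

theorem stepFun_scaleStep (c m : ℕ) (x : X) : stepFun S ennrealLattice (scaleStep c m) x =
    if dist x (S.ideal (stepCenter m)) < stepRadius m
      then (2⁻¹ : ℝ≥0∞) ^ (c + 3) * stepValue m else 0 := by
  have h : (nnRatNum (scaleStep c m).unpair.2 : ℝ≥0∞) = (2⁻¹ : ℝ≥0∞) ^ (c + 3) * stepValue m := by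
    rw [nnRatNum_unpair_snd]
    have h2 : 2 ^ (c + 3) - 1 + 1 = 2 ^ (c + 3) := Nat.sub_add_cancel Nat.one_le_two_pow
    simp only [scaleStep, stepValue, Nat.unpair_pair, h2]
    rw [mul_comm, div_eq_mul_inv, ← ENNReal.inv_pow]
    push_cast
    rfl
  have h1 : stepCenter (scaleStep c m) = stepCenter m := by simp [stepCenter, scaleStep]
  have h2 : stepRadius (scaleStep c m) = stepRadius m := by simp [stepRadius, scaleStep]
  rw [stepFun_apply, h, h1, h2]

theorem describes_iff (E : Set ℕ) (f : LowerFun S ennrealLattice) :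
    (LowerFun.enumerativeLattice S ennrealLattice).Describes E f ↔
      f.1 = ⨆ n ∈ E, stepFun S ennrealLattice n := by
  have e : (⨆ n ∈ E, (LowerFun.enumerativeLattice S ennrealLattice).elem n).1 =
      ⨆ n ∈ E, stepFun S ennrealLattice n := by
    rw [LowerFun.coe_iSup]
    simp only [LowerFun.coe_iSup]
    rfl
  exact ⟨fun h => (congrArg Subtype.val h).trans e, fun h => Subtype.ext (h.trans e.symm)⟩

end Steps

/-! ### The universal test -/

section Universal

variable {X : Type*} [MetricSpace X] [CompleteSpace X] [MeasurableSpace X] [BorelSpace X]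
  (S : ComputableMetricSpace X)

/-- The partial recursive function with code `c`, applied to a prefix `u ++ [b]` of a name, lists a
step function which is refined by the step function `m`. -/
def Produces (c b l m : ℕ) : Prop :=
  ∃ u : List ℕ, ∃ n : ℕ, (l = u.length + 1 ∧ StepRefines m n) ∧
    IsNamePrefix (idealMeasure S) (u ++ [b]) ∧
    ∃ k : ℕ, ∃ L : List ℕ, (Denumerable.ofNat Nat.Partrec.Code c).evaln k
      (Encodable.encode (u ++ [b])) = some (Encodable.encode L) ∧ n ∈ L

theorem semiDec_isNamePrefix : SemiDec (IsNamePrefix (idealMeasure S)) := by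
  unfold IsNamePrefix
  have h : ∀ (d : ℝ) (j : ℕ), d < (1 / 2 : ℝ) ^ j ↔ d * (2 ^ j : ℕ) < (1 : ℕ) := by
    intro d j
    rw [one_div, inv_pow, ← one_div, lt_div_iff₀ (by positivity)]
    push_cast
    rfl
  simp only [h]
  refine .forall_lt (.exists_ (.exists_ (.and (.of_primrecPred (.and
    (primrecPred_eq (by fun_prop) (by fun_prop)) (primrecPred_eq (by fun_prop) (by fun_prop))))
    ?_))) (by fun_prop)
  exact (semiDec_dist_idealMeasure_mul_lt S).comp (f := fun x : ((List ℕ × ℕ) × ℕ) × ℕ =>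
    ((x.1.2, x.2), (1, 2 ^ x.1.1.2))) (by fun_prop)

theorem semiDec_produces : SemiDec fun x : ℕ × ℕ × ℕ × ℕ => Produces S x.1 x.2.1 x.2.2.1 x.2.2.2 := by
  unfold Produces StepRefines
  refine .exists_ (.exists_ (.and (.of_primrecPred (.and (primrecPred_eq (by fun_prop) (by fun_prop))
    (.and (.and (primrecPred_eq (by fun_prop) (by fun_prop))
      (primrecPred_lt (by fun_prop) (by fun_prop)))
    (.and (primrecPred_eq (by fun_prop) (by fun_prop))
      (primrecPred_le (by fun_prop) (by fun_prop)))))) (.and ?_ ?_)))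
  · exact (semiDec_isNamePrefix S).comp (f := fun x : ((ℕ × ℕ × ℕ × ℕ) × List ℕ) × ℕ =>
      x.1.2 ++ [x.1.1.2.1]) (by fun_prop)
  · exact .exists_ (.exists_ (.and (.of_primrecPred (primrecPred_eq (by fun_prop) (by fun_prop)))
      (.of_primrecPred (primrecPred_mem (by fun_prop) (by fun_prop)))))

/-- A primitive recursive enumeration of the atoms, for all codes at once. -/
theorem exists_atoms : ∃ P : ℕ → ℕ → Prop, PrimrecPred (fun x : ℕ × ℕ => P x.1 x.2) ∧
    (∀ c i, P c i → Produces S c (atomMeasure i) (atomExponent i) (atomStep i)) ∧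
    ∀ c b l m, Produces S c b l m → ∃ i, P c i ∧ atomMeasure i = b ∧ atomExponent i = l ∧
      atomStep i = m := by
  obtain ⟨r, hr, h⟩ := semiDec_produces S
  -- The last component of `i` is the witness of semidecidability; carrying it inside the atom makes
  -- `P` primitive recursive.
  refine ⟨fun c i => r ((c, atomMeasure i, atomExponent i, atomStep i), i.unpair.2.unpair.2),
    hr.comp (by fun_prop), fun c i hi => (h (c, _, _, _)).2 ⟨_, hi⟩, fun c b l m hp => ?_⟩
  obtain ⟨t, ht⟩ := (h (c, b, l, m)).1 hp
  refine ⟨Nat.pair (Nat.pair b l) (Nat.pair m t), ?_⟩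
  simpa [atomMeasure, atomExponent, atomStep] using ht

/-- The codes of the step functions whose supremum is the universal test. -/
def universalCodes (P : ℕ → ℕ → Prop) (μ : LevyProkhorov (ProbabilityMeasure X)) : Set ℕ :=
  {m | m.unpair.2 = Nat.pair 1 1} ∪
    {m | ∃ c i, i ∈ trimmed S (P c) μ ∧ m = scaleStep c (atomStep i)}

/-- The universal test obtained by trimming an enumeration of atoms. -/
noncomputable def universalTest (P : ℕ → ℕ → Prop) (μ : LevyProkhorov (ProbabilityMeasure X)) :
    LowerFun S ennrealLattice :=
  ⟨⨆ n ∈ universalCodes S P μ, stepFun S ennrealLattice n, universalCodes S P μ, rfl⟩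

theorem exists_recursiveOperator_universalCodes {P : ℕ → ℕ → Prop}
    (hP : PrimrecPred fun x : ℕ × ℕ => P x.1 x.2) :
    ∃ F, IsRecursiveOperator F ∧ ∀ μ σ, IsCauchyName (idealMeasure S) σ μ →
      operatorOutput F σ = universalCodes S P μ := by
  have hR : SemiDec fun x : List ℕ × ℕ => x.2.unpair.2 = Nat.pair 1 1 ∨
      ∃ y : (ℕ × ℕ) × ℕ × ℕ, (x.1[y.2.2 + 1]? = some y.2.1 ∧
        x.2 = scaleStep y.1.1 (atomStep y.1.2) ∧ P y.1.1 y.1.2) ∧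
        TrimCertificate S (P y.1.1) y.1.2 y.2.1 y.2.2 := by
    unfold scaleStep
    refine .or (.of_primrecPred (primrecPred_eq (by fun_prop) (by fun_prop))) (.exists_
      (.and (.of_primrecPred (.and (primrecPred_eq (by fun_prop) (by fun_prop))
        (.and (primrecPred_eq (by fun_prop) (by fun_prop)) ?_))) ?_))
    · exact hP.comp (f := fun x : (List ℕ × ℕ) × (ℕ × ℕ) × ℕ × ℕ => x.2.1) (by fun_prop)
    · exact (semiDec_trimCertificate S hP).comp Primrec.snd
  obtain ⟨F, hF, h⟩ := exists_recursiveOperator hR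
  refine ⟨F, hF, fun μ σ hσ => ?_⟩
  -- A term of an arbitrary name has error up to `2 * 2 ^ (-n)`; the shift by one removes the factor
  -- 2.
  have hτ : ∀ k, dist (idealMeasure S (σ (k + 1))) μ < (1 / 2 : ℝ) ^ k := by
    intro k
    have := hσ.dist_lt (k + 1)
    rw [pow_succ] at this
    linarith
  rw [h]
  ext m
  simp only [universalCodes, Set.mem_ofPred_eq, Set.mem_union]
  constructor
  · rintro ⟨K, hm | ⟨⟨⟨c, i⟩, a, k⟩, ⟨h1, h2, h3⟩, h4⟩⟩
    · exact Or.inl hm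
    · refine Or.inr ⟨c, i, h4.mem_trimmed h3 ?_, h2⟩
      obtain ⟨n, hn, rfl⟩ := List.mem_map.1 (List.mem_of_getElem? h1)
      have hk : k + 1 < K := by
        by_contra hk
        rw [List.getElem?_eq_none (by simpa using hk)] at h1
        cases h1
      rw [List.getElem?_map, List.getElem?_range hk] at h1
      obtain h1 : σ (k + 1) = σ n := Option.some_inj.1 h1
      rw [← h1]
      exact hτ k
  · rintro (hm | ⟨c, i, hi, hm⟩)
    · exact ⟨0, Or.inl hm⟩
    · obtain ⟨k, hk⟩ := exists_trimCertificate hi hτ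
      refine ⟨k + 2, Or.inr ⟨((c, i), σ (k + 1), k), ⟨?_, hm, hi.1⟩, hk⟩⟩
      show ((List.range (k + 2)).map σ)[k + 1]? = some (σ (k + 1))
      rw [List.getElem?_map, List.getElem?_range (by omega)]
      rfl

theorem isConstructive_universalTest {P : ℕ → ℕ → Prop}
    (hP : PrimrecPred fun x : ℕ × ℕ => P x.1 x.2) :
    IsConstructive (idealMeasure S) (LowerFun.enumerativeLattice S ennrealLattice)
      (universalTest S P) := by
  obtain ⟨F, hF, h⟩ := exists_recursiveOperator_universalCodes S hP
  refine ⟨F, hF, fun μ σ hσ => ?_⟩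
  rw [describes_iff, h μ σ hσ]
  rfl

/-- The supremum of the atoms enumerated while their integral is below `2`. -/
noncomputable def trimmedSup (P : ℕ → Prop) (μ : LevyProkhorov (ProbabilityMeasure X)) (x : X) :
    ℝ≥0∞ :=
  ⨆ i : {i : ℕ // ∫⁻ x, (cap S (activeAtoms S P μ i) 0 x : ℝ≥0∞) ∂(μ.toMeasure : Measure X) < 2},
    (cap S (activeAtoms S P μ i) 0 x : ℝ≥0∞)

variable {S}

theorem measurable_trimmedSup (P : ℕ → Prop) (μ : LevyProkhorov (ProbabilityMeasure X)) :
    Measurable (trimmedSup S P μ) :=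
  Measurable.iSup fun i => measurable_from_top.comp (measurable_cap (activeAtoms S P μ i) 0)

/-- The active atoms increase with `i`, so the family is directed and monotone convergence applies.
-/
theorem lintegral_trimmedSup_le (P : ℕ → Prop) (μ : LevyProkhorov (ProbabilityMeasure X)) :
    ∫⁻ x, trimmedSup S P μ x ∂(μ.toMeasure : Measure X) ≤ 2 := by
  unfold trimmedSup
  refine (lintegral_iSup_directed (f := fun (i : {i : ℕ // ∫⁻ x,
    (cap S (activeAtoms S P μ i) 0 x : ℝ≥0∞) ∂(μ.toMeasure : Measure X) < 2}) x =>
      (cap S (activeAtoms S P μ i) 0 x : ℝ≥0∞)) (fun i => (measurable_from_top.comp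
    (measurable_cap (activeAtoms S P μ i) 0)).aemeasurable) ?_).trans_le
    (iSup_le fun i => i.2.le)
  · refine directed_of_isDirected_le fun i j hij x => ?_
    refine Nat.cast_le.2 (cap_le_cap (fun n hn => ?_) (by simp))
    rw [mem_activeAtoms] at hn ⊢
    exact ⟨hn.1.trans_le (Nat.succ_le_succ hij), hn.2⟩

theorem le_trimmedSup {P : ℕ → Prop} {μ : LevyProkhorov (ProbabilityMeasure X)} {i : ℕ}
    (hi : i ∈ trimmed S P μ) {x : X}
    (hx : dist x (S.ideal (stepCenter (atomStep i))) < stepRadius (atomStep i)) :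
    (stepValue (atomStep i) : ℝ≥0∞) ≤ trimmedSup S P μ x := by
  refine le_iSup_of_le ⟨i, hi.2.2⟩ (Nat.cast_le.2 (le_cap ?_ (by simpa using hx.le)))
  exact mem_activeAtoms.2 ⟨Nat.lt_succ_self i, hi.1, hi.2.1.le⟩

theorem universalTest_le (P : ℕ → ℕ → Prop) (μ : LevyProkhorov (ProbabilityMeasure X)) (x : X) :
    universalTest S P μ x ≤
      2⁻¹ + ∑' c, (2⁻¹ : ℝ≥0∞) ^ (c + 3) * trimmedSup S (P c) μ x := by
  show (⨆ n ∈ universalCodes S P μ, stepFun S ennrealLattice n) x ≤ _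
  simp only [iSup_apply]
  refine iSup₂_le fun n hn => ?_
  rcases hn with hn | ⟨c, i, hi, rfl⟩
  · refine le_add_right ?_
    rw [stepFun_apply]
    split_ifs
    · rw [show n.unpair.2 = Nat.pair 1 1 from hn, nnRatNum]
      simp only [Nat.unpair_pair]
      rw [ENNReal.coe_div (by positivity)]
      norm_num
    · exact zero_le
  · refine le_add_left (le_trans ?_ (ENNReal.le_tsum c))
    rw [stepFun_scaleStep]
    split_ifs with h
    · gcongr
      exact le_trimmedSup hi h
    · exact zero_le

/-- The supremum over the codes is bounded by a sum, and the weights `2 ^ (-(c + 3))` add up to 1/4.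
-/
theorem lintegral_universalTest_le_one (P : ℕ → ℕ → Prop)
    (μ : LevyProkhorov (ProbabilityMeasure X)) :
    ∫⁻ x, universalTest S P μ x ∂(μ.toMeasure : Measure X) ≤ 1 := by
  refine (lintegral_mono (universalTest_le P μ)).trans ?_
  rw [lintegral_add_left measurable_const, lintegral_tsum fun c =>
    ((measurable_trimmedSup (P c) μ).const_mul _).aemeasurable]
  simp only [lintegral_const, measure_univ, mul_one,
    lintegral_const_mul _ (measurable_trimmedSup (P _) μ)]
  calc (2⁻¹ : ℝ≥0∞) + ∑' c, (2⁻¹ : ℝ≥0∞) ^ (c + 3) *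
        ∫⁻ x, trimmedSup S (P c) μ x ∂(μ.toMeasure : Measure X)
      ≤ 2⁻¹ + ∑' c : ℕ, (2⁻¹ : ℝ≥0∞) ^ (c + 3) * 2 := by
        gcongr with c
        exact lintegral_trimmedSup_le (P c) μ
    _ = 2⁻¹ + 2⁻¹ := by
        simp only [pow_add]
        rw [ENNReal.tsum_mul_right, ENNReal.tsum_mul_right, ENNReal.tsum_geometric_two]
        congr 1
        rw [pow_succ, pow_succ, pow_one, mul_assoc, mul_assoc,
          ENNReal.inv_mul_cancel two_ne_zero ENNReal.ofNat_ne_top, mul_one, ← mul_assoc,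
          ENNReal.mul_inv_cancel two_ne_zero ENNReal.ofNat_ne_top, one_mul]
    _ = 1 := ENNReal.inv_two_add_inv_two

theorem half_le_universalTest (P : ℕ → ℕ → Prop) (μ : LevyProkhorov (ProbabilityMeasure X))
    (x : X) : 2⁻¹ ≤ universalTest S P μ x := by
  obtain ⟨i, hi⟩ := S.dense.exists_dist_lt x one_pos
  show _ ≤ (⨆ n ∈ universalCodes S P μ, stepFun S ennrealLattice n) x
  simp only [iSup_apply]
  refine le_iSup₂_of_le (Nat.pair (Nat.pair i (Nat.pair 0 0)) (Nat.pair 1 1))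
    (Or.inl (by simp)) ?_
  rw [stepFun_apply, if_pos (by simpa [stepCenter, stepRadius, posRatNum] using hi)]
  simp only [Nat.unpair_pair, nnRatNum]
  rw [ENNReal.coe_div (by positivity)]
  norm_num

theorem mul_stepValue_le_universalTest {P : ℕ → ℕ → Prop}
    {μ : LevyProkhorov (ProbabilityMeasure X)} {c i : ℕ} (hi : i ∈ trimmed S (P c) μ) {x : X}
    (hx : dist x (S.ideal (stepCenter (atomStep i))) < stepRadius (atomStep i)) :
    (2⁻¹ : ℝ≥0∞) ^ (c + 3) * stepValue (atomStep i) ≤ universalTest S P μ x := by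
  show _ ≤ (⨆ n ∈ universalCodes S P μ, stepFun S ennrealLattice n) x
  simp only [iSup_apply]
  refine le_iSup₂_of_le (scaleStep c (atomStep i)) (Or.inr ⟨c, i, hi, rfl⟩) ?_
  rw [stepFun_scaleStep, if_pos hx]

/-- The closed ball of radius `2 ^ (-l)` lies in the open ball of twice that radius, where each
measure has a name extending `u ++ [b]`; on such a name `F` lists `n`. Likewise the closed ball of
`m` lies in the open ball of `n`. -/
theorem Produces.stepValue_le {T : LevyProkhorov (ProbabilityMeasure X) → LowerFun S ennrealLattice}
    {F : List ℕ → List ℕ} {c : ℕ}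
    (hc : ∀ u, (Denumerable.ofNat Nat.Partrec.Code c).eval (Encodable.encode u) =
      Part.some (Encodable.encode (F u)))
    (hF : ∀ μ σ, IsCauchyName (idealMeasure S) σ μ →
      (LowerFun.enumerativeLattice S ennrealLattice).Describes (operatorOutput F σ) (T μ))
    {b l m : ℕ} (h : Produces S c b l m) {μ : LevyProkhorov (ProbabilityMeasure X)}
    (hμ : dist (idealMeasure S b) μ ≤ (1 / 2 : ℝ) ^ l) {x : X}
    (hx : dist x (S.ideal (stepCenter m)) ≤ stepRadius m) :
    (stepValue m : ℝ≥0∞) ≤ T μ x := by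
  obtain ⟨u, n, ⟨rfl, hmn⟩, hu, k, L, hL, hn⟩ := h
  have hL' : L = F (u ++ [b]) :=
    Encodable.encode_injective ((exists_evaln_eq_iff (hc (u ++ [b]))).1 ⟨k, hL⟩)
  have hb : dist (idealMeasure S b) μ < (1 / 2 : ℝ) ^ u.length := by
    refine hμ.trans_lt ?_
    rw [pow_succ]
    have : (0 : ℝ) < (1 / 2) ^ u.length := by positivity
    linarith
  obtain ⟨σ, hσ, hσu⟩ := hu.exists_isCauchyName
    (fun ν ε hε => exists_dist_idealMeasure_lt S ν hε) hb
  have h1 := (describes_iff S _ _).1 (hF μ σ hσ)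
  rw [h1]
  simp only [iSup_apply]
  refine le_iSup₂_of_le n ⟨u.length + 1, by rw [hσu, ← hL']; exact hn⟩ ?_
  rw [stepFun_apply, if_pos (by rw [← hmn.1.1]; exact hx.trans_lt hmn.stepRadius_lt)]
  exact hmn.stepValue_le

theorem exists_mul_le_universalTest {P : ℕ → ℕ → Prop}
    (hP1 : ∀ c i, P c i → Produces S c (atomMeasure i) (atomExponent i) (atomStep i))
    (hP2 : ∀ c b l m, Produces S c b l m → ∃ i, P c i ∧ atomMeasure i = b ∧ atomExponent i = l ∧
      atomStep i = m)
    {T : LevyProkhorov (ProbabilityMeasure X) → LowerFun S ennrealLattice}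
    (hT : IsUniformTest S T) :
    ∃ r : ℝ≥0, 0 < r ∧ ∀ μ x, (r : ℝ≥0∞) * T μ x ≤ universalTest S P μ x := by
  obtain ⟨⟨F, hF, hFT⟩, hint⟩ := hT
  obtain ⟨code, hcode⟩ := exists_code_of_computable hF.computable
  set c := Encodable.encode code with hc
  have hcode' : ∀ u, (Denumerable.ofNat Nat.Partrec.Code c).eval (Encodable.encode u) =
      Part.some (Encodable.encode (F u)) := by
    intro u
    rw [hc, Denumerable.ofNat_encode, hcode]
  -- All active atoms lie below `T μ`, so no atom of the code `c` is ever trimmed.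
  have hcap : ∀ μ i, ∫⁻ x, (cap S (activeAtoms S (P c) μ i) 0 x : ℝ≥0∞)
      ∂(μ.toMeasure : Measure X) < 2 := by
    intro μ i
    refine lt_of_le_of_lt ((lintegral_mono fun x => ?_).trans (hint μ)) ENNReal.one_lt_two
    rw [cap, Finset.apply_sup_eq_sup_comp (fun n : ℕ => (n : ℝ≥0∞))
      (fun a b => (Nat.mono_cast (α := ℝ≥0∞)).map_sup a b) (by simp)]
    refine Finset.sup_le fun j hj => ?_
    obtain ⟨-, hj1, hj2⟩ := mem_activeAtoms.1 hj
    simp only [Function.comp]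
    split_ifs with hx
    · exact (hP1 c j hj1).stepValue_le hcode' hFT hj2 (by simpa using hx)
    · simp
  refine ⟨2⁻¹ ^ (c + 4), by positivity, fun μ x => ?_⟩
  obtain ⟨τ, hτ, hτ'⟩ := exists_fastName
    (fun ν ε hε => exists_dist_idealMeasure_lt S ν hε) μ
  have h1 := (describes_iff S _ _).1 (hFT μ τ hτ)
  rw [h1]
  simp only [iSup_apply, ENNReal.mul_iSup]
  refine iSup₂_le fun n hn => ?_
  rw [stepFun_apply]
  split_ifs with hx
  swap
  · simp
  obtain ⟨m, hmn, hm1, hm2⟩ := exists_stepRefines dist_nonneg hx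
  obtain ⟨K, hK⟩ := hn
  -- The prefix is lengthened by one term so that it is nonempty and ends in some `b`; by
  -- monotonicity `F` still lists `n`.
  have hpre : (List.range K).map τ <+: (List.range (K + 1)).map τ := by
    rw [List.range_succ, List.map_append]
    exact List.prefix_append _ _
  have hK' := (hF.monotone _ _ hpre).subset hK
  have hu : (List.range (K + 1)).map τ = (List.range K).map τ ++ [τ K] := by
    rw [List.range_succ, List.map_append]
    rfl
  have hprod : Produces S c (τ K) (K + 1) m := by
    obtain ⟨k, hk⟩ := (exists_evaln_eq_iff (hcode' ((List.range (K + 1)).map τ))).2 rfl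
    rw [hu] at hk hK'
    exact ⟨(List.range K).map τ, n, ⟨by simp, hmn⟩, hu ▸ hτ.isNamePrefix (K + 1), k, _, hk, hK'⟩
  obtain ⟨i, hi, hi1, hi2, hi3⟩ := hP2 _ _ _ _ hprod
  have hmem : i ∈ trimmed S (P c) μ := ⟨hi, by rw [hi1, hi2]; exact hτ' K, hcap μ i⟩
  have h2 := mul_stepValue_le_universalTest hmem (x := x) (by
    rw [hi3, hmn.1.1]
    exact hm1)
  rw [hi3] at h2
  have h3 : (2⁻¹ : ℝ≥0∞) ^ (c + 3) ≤ universalTest S P μ x := by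
    refine le_trans ?_ (half_le_universalTest P μ x)
    calc (2⁻¹ : ℝ≥0∞) ^ (c + 3) ≤ 2⁻¹ ^ 1 :=
          pow_le_pow_right_of_le_one' (by simp) (by omega)
      _ = 2⁻¹ := pow_one _
  have hr : ((2⁻¹ ^ (c + 4) : ℝ≥0) : ℝ≥0∞) = 2⁻¹ * (2⁻¹ : ℝ≥0∞) ^ (c + 3) := by
    rw [ENNReal.coe_pow, ENNReal.coe_inv two_ne_zero, ← pow_succ']
    rfl
  -- One half of the universal test pays for the integer part of the value, the other half for the
  -- rounding error 1; this accounts for the exponent `c + 4`.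
  calc ((2⁻¹ ^ (c + 4) : ℝ≥0) : ℝ≥0∞) * nnRatNum n.unpair.2
      ≤ 2⁻¹ * (2⁻¹ : ℝ≥0∞) ^ (c + 3) * (stepValue m + 1) := by
        rw [hr]
        gcongr
    _ = 2⁻¹ * ((2⁻¹ : ℝ≥0∞) ^ (c + 3) * stepValue m) + 2⁻¹ * (2⁻¹ : ℝ≥0∞) ^ (c + 3) := by ring
    _ ≤ 2⁻¹ * universalTest S P μ x + 2⁻¹ * universalTest S P μ x := by gcongr
    _ = universalTest S P μ x := by rw [← add_mul, ENNReal.inv_two_add_inv_two, one_mul]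

end Universal

end CompMetric

theorem mainTheorem2 {X : Type*} [MetricSpace X] [CompleteSpace X] [MeasurableSpace X]
    [BorelSpace X] (S : CompMetric.ComputableMetricSpace X) :
    ∃ Tu : LevyProkhorov (ProbabilityMeasure X) →
        CompMetric.LowerFun S CompMetric.ennrealLattice,
      CompMetric.IsUniformTest S Tu ∧
      ∀ T : LevyProkhorov (ProbabilityMeasure X) →
          CompMetric.LowerFun S CompMetric.ennrealLattice,
        CompMetric.IsUniformTest S T →
        ∃ c : ℝ≥0, 0 < c ∧ ∀ μ x, (c : ℝ≥0∞) * T μ x ≤ Tu μ x := by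
  obtain ⟨P, hP, hP1, hP2⟩ := CompMetric.exists_atoms S
  exact ⟨CompMetric.universalTest S P, ⟨CompMetric.isConstructive_universalTest S hP,
    CompMetric.lintegral_universalTest_le_one P⟩,
    fun T hT => CompMetric.exists_mul_le_universalTest hP1 hP2 hT⟩
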